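/- **Setting.** Let $\mathbf M\subset\mathbf R^s$ be a compact $m$-dimensional $C^\infty$ submanifold without boundary. Its cutlocus $\mathbf C$ is the set of $x\in\mathbf R^s$ for which the point $\pi(x)$ of $\mathbf M$ nearest to $x$ is not unique, or for which the function $L_x(\mu)=\|\mu-x\|^2$ on $\mathbf M$ has a degenerate second derivative at $\mu=\pi(x)$; let $\pi:\mathbf R^s\setminus\mathbf C\to\mathbf M$ be the nearest-point mapping. For $\mu\in\mathbf M$ let $\tan_\mu$ and $\mathrm{nor}_\mu=\mathrm I_s-\tan_\mu$ be the orthogonal projections of $\mathbf R^s$ onto the tangent space $T_\mu\mathbf M$ and the normal space $(T_\mu\mathbf M)^\perp$. For a normal vector $v_\mu$ at $\mu$ let $A_{v_\mu}:T_\mu\mathbf M\to T_\mu\mathbf M$, $A_{v_\mu}(w)=-\tan_\mu(D_w v)$, be the Weingarten mapping, where $v$ is a smooth normal vector field on $\mathbf M$ with $v(\mu)=v_\mu$ (e.g. $v(\alpha)=\mathrm{nor}_\alpha(v_\mu)$). Matrix norms are operator norms, and $d(t,\mathbf C)$ is the Euclidean distance from $t$ to $\mathbf C$ (with $1/d(t,\mathbf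 C)=0$ if $\mathbf C=\emptyset$). Let $t_n\in\mathbf R^s$, let $\tilde t_n$ be random vectors in $\mathbf R^s$ (possibly on different probability spaces), let $B_n$ be nonsingular $s\times s$ matrices with $B_n\to0$, and suppose that $$Z_n=B_n^{-1}(\tilde t_n-t_n)\xrightarrow{\mathcal D}Z\qquad(2.1)$$ for some random vector $Z=(Z_1,\dots,Z_s)$ in $\mathbf R^s$. Put $\mu_n=\pi(t_n)$ and $\tilde\mu_n=\pi(\tilde t_n)$, where $\tilde\mu_n$ is a random vector whose values on the event $\tilde t_n\in\mathbf C$ are arbitrary, and $$G_n=(\mathrm{Id}_{T_{\mu_n}\mathbf M}-A_{t_n-\mu_n})\tan_{\mu_n}+\mathrm{nor}_{\mu_n}.$$ **Theorem 2.2.** Suppose that $t_n\notin\mathbf C$ and $d(t_n,\mathbf M)\le D$ for all $n$ and some $D>0$, and that $B_n/d(t_n,\mathbf C)\to0$. Let $\Gamma_n$ be $s\times s$ matrices such that $$\|\Gamma_n\|\,\|B_n\|^2/d(t_n,\mathbf C)^2\to0.\qquad(2.6)$$ Then 1. $\Gamma_nG_n(\tilde\mu_n-\mu_n)-\Gamma_n\tan_{\mu_n}B_nZ_n\xrightarrow{P}0$.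 Suppose furthermore that $Z$ is spherical (that is, $HZ$ and $Z$ have the same distribution for every orthogonal matrix $H$) and that, for all $n$, $$\Gamma_n\tan_{\mu_n}B_nB_n^T\tan_{\mu_n}\Gamma_n^T=\tan_{\mu_n}.\qquad(2.7)$$ Then 2. if $\mu_n\to\mu$ for some $\mu\in\mathbf M$, then $\Gamma_nG_n(\tilde\mu_n-\mu_n)\xrightarrow{\mathcal D}\tan_\mu Z$; 3. without any restriction on $\mu_n$, $(\tilde\mu_n-\mu_n)^TG_n\Gamma_n^T\Gamma_nG_n(\tilde\mu_n-\mu_n)\xrightarrow{\mathcal D}\zeta_m^2$, where $\zeta_m^2$ denotes the distribution of $\sum_{i=1}^mZ_i^2$. -/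

import Mathlib

open MeasureTheory ProbabilityTheory Filter Topology

noncomputable section

namespace CutLocus

variable {E : Type*} [NormedAddCommGroup E] [InnerProductSpace ℝ E]

/-- A smooth slice chart of the subset `M`: a `C^∞` diffeomorphism `Φ` between open subsets of the
ambient space that carries `M` (inside the source of `Φ`) onto the linear subspace `V`
(inside the target of `Φ`). -/
structure IsSliceChart (M : Set E) (V : Submodule ℝ E) (Φ : OpenPartialHomeomorph E E) :
    Prop where
  contDiffOn_toFun : ContDiffOn ℝ (⊤ : ℕ∞) Φ Φ.source
  contDiffOn_symm : ContDiffOn ℝ (⊤ : ℕ∞) Φ.symm Φ.target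
  mem_iff : ∀ x ∈ Φ.source, x ∈ M ↔ Φ x ∈ V

/-- `M` is an `m`-dimensional embedded `C^∞` submanifold (without boundary). -/
def IsSubmanifold (m : ℕ) (M : Set E) : Prop :=
  ∀ p ∈ M, ∃ (V : Submodule ℝ E) (Φ : OpenPartialHomeomorph E E),
    IsSliceChart M V Φ ∧ p ∈ Φ.source ∧ Module.finrank ℝ V = m

/-- The tangent space `T_p M` as a linear subspace of the ambient space: the velocities at `p` of
smooth curves in `M` through `p`. (For a submanifold these already form a linear subspace.) -/
def tangentSpace (M : Set E) (p : E) : Submodule ℝ E :=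
  Submodule.span ℝ {v | ∃ γ : ℝ → E, ContDiffAt ℝ (⊤ : ℕ∞) γ 0 ∧ (∀ᶠ r in 𝓝 0, γ r ∈ M) ∧
    γ 0 = p ∧ deriv γ 0 = v}

/-- `p` is a point of `M` nearest to `x`, i.e. `p` minimizes `‖q - x‖ ^ 2` over `q ∈ M`. -/
def IsNearestPoint (M : Set E) (x p : E) : Prop :=
  p ∈ M ∧ ∀ q ∈ M, ‖p - x‖ ^ 2 ≤ ‖q - x‖ ^ 2

/-- The nearest-point mapping `π`. It is only meaningful where the nearest point is unique, in
particular off the cutlocus. -/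
def nearestPoint (M : Set E) (x : E) : E :=
  Classical.epsilon (IsNearestPoint M x)

/-- The restriction to `M` of the function `f` has a degenerate second derivative at its critical
point `p`: in a slice chart the bilinear form of second derivatives of `f`, along the slice, has a
nonzero vector in its kernel. (At a critical point this does not depend on the chart.) -/
def HasDegenerateHessian (M : Set E) (f : E → ℝ) (p : E) : Prop :=
  ∃ (V : Submodule ℝ E) (Φ : OpenPartialHomeomorph E E),
    IsSliceChart M V Φ ∧ p ∈ Φ.source ∧
      ∃ u ∈ V, u ≠ 0 ∧ ∀ v ∈ V, fderiv ℝ (fderiv ℝ (f ∘ Φ.symm)) (Φ p) u v = 0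

/-- The cutlocus of `M`: the points `x` whose nearest point `π x` on `M` is not uniquely defined,
or for which the squared distance to `x` on `M` has a degenerate second derivative at `π x`. -/
def cutlocus (M : Set E) : Set E :=
  {x | (¬ ∃! p, IsNearestPoint M x p) ∨
    HasDegenerateHessian M (fun q => ‖q - x‖ ^ 2) (nearestPoint M x)}

variable [FiniteDimensional ℝ E]

/-- `tan_p`, the orthogonal projection of the ambient space onto `T_p M`. -/
def tanProj (M : Set E) (p : E) : E →L[ℝ] E :=
  (tangentSpace M p).starProjection

/-- `nor_p = I - tan_p`, the orthogonal projection onto the normal space `N_p M`. -/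
def norProj (M : Set E) (p : E) : E →L[ℝ] E :=
  ContinuousLinearMap.id ℝ E - tanProj M p

/-- The Weingarten mapping `A_ν : T_p M → T_p M` of a normal vector `ν ∈ N_p M`:
`A_ν w = - tan_p (D_w v)`, where `v` is the normal field `v α = nor_α ν` on `M`. -/
def weingarten (M : Set E) (p ν : E) : tangentSpace M p →L[ℝ] tangentSpace M p :=
  -((tangentSpace M p).orthogonalProjectionOnto ∘L
    fderivWithin ℝ (fun α => norProj M α ν) M p ∘L (tangentSpace M p).subtypeL)

/-- `G = (Id_μ - A_{t - μ}) tan_μ + nor_μ` with `μ = π t`, as an endomorphism of the ambient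
space. -/
def stabilizer (M : Set E) (t : E) : E →L[ℝ] E :=
  (tangentSpace M (nearestPoint M t)).subtypeL ∘L
      (ContinuousLinearMap.id ℝ (tangentSpace M (nearestPoint M t)) -
        weingarten M (nearestPoint M t) (t - nearestPoint M t)) ∘L
      (tangentSpace M (nearestPoint M t)).orthogonalProjectionOnto +
    norProj M (nearestPoint M t)

/-- Convergence to `0` in probability of random vectors that may live on different
probability spaces. -/
def TendstoZeroInProbability {F : Type*} [NormedAddCommGroup F] {Ω : ℕ → Type*}
    [∀ n, MeasurableSpace (Ω n)] (P : ∀ n, Measure (Ω n)) (X : ∀ n, Ω n → F) : Prop :=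
  ∀ ε : ℝ, 0 < ε → Tendsto (fun n => P n {ω | ε ≤ ‖X n ω‖}) atTop (𝓝 0)

/-- A random vector is spherical if its law is invariant under all linear isometries. -/
def IsSpherical [MeasurableSpace E] {Ω : Type*} [MeasurableSpace Ω] (Z : Ω → E)
    (P : Measure Ω) : Prop :=
  ∀ H : E ≃ₗᵢ[ℝ] E, IdentDistrib (fun ω => H (Z ω)) Z P P

end CutLocus

end

set_option linter.unusedSectionVars false

/-! The analytic core is a first-order expansion of the nearest-point mapping with remainder of
order `‖t' - t‖ ^ 2 / d ^ 2`, where `d` is the distance from `t` to the cutlocus, uniformly for `t`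
within distance `D` of `M`. Write `p = π t` and `q = π t'`. Since `t - p` and `t' - q` are normal,
applying the projection `tan_q` to `t' - q` and expanding `tan_q` around `p` along `M` gives `(I -
A_{t-p}) (q - p) ≈ tan_p (t' - t)`, with errors of order `‖q - p‖ ^ 2` and `‖q - p‖ ‖t' - t‖`
(`PairBound.norm_remainder_le`).

It remains to bound `‖q - p‖` by a multiple of `‖t' - t‖ / d`. Off the cutlocus the squared distance
grows quadratically away from the foot point, locally uniformly (`IsSubmanifold.exists_quadGrowth`).
Hence the cutlocus is closed, and a foot point stays nearest along its normal ray until the ray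
meets the cutlocus (`IsSubmanifold.isNearestPoint_ray`). The sharpened inequalities obtained by
prolonging the normal segments at `t` and at `t'` add up to the Lipschitz bound
`IsSubmanifold.norm_nearestPoint_sub_le`.

Tightness of `Zₙ` turns the expansion into convergence in probability. For the limit laws, `Qₙ = Γₙ
tan Bₙ` satisfies `Qₙ Qₙ* = tan`, so the `Qₙ` are bounded and every limit point is `tan_μ H` with
`H` orthogonal; sphericity removes `H`. When `μₙ` does not converge, compactness of `M` supplies
convergent subsequences, and the law of `‖tan_μ Z‖ ^ 2` depends on the dimension `m` only. -/

noncomputable section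

namespace CutLocus

variable {E : Type*} [NormedAddCommGroup E] [InnerProductSpace ℝ E]

/-! ### Calculus: Taylor estimates and second-derivative tests. -/

section Calculus

variable {F G : Type*} [NormedAddCommGroup F] [NormedSpace ℝ F] [NormedAddCommGroup G]
  [NormedSpace ℝ G]

/-- Second order Taylor estimate with a moving base point. -/
theorem exists_norm_sub_sub_fderiv_le {f : F → G} {x₀ : F} (hf : ContDiffAt ℝ 2 f x₀) :
    ∃ K : ℝ, 0 ≤ K ∧ ∃ δ > 0, ∀ p ∈ Metric.ball x₀ δ, ∀ q ∈ Metric.ball x₀ δ,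
      ‖f q - f p - fderiv ℝ f p (q - p)‖ ≤ K * ‖q - p‖ ^ 2 := by
  have h1 : ContDiffAt ℝ 1 (fderiv ℝ f) x₀ := hf.fderiv_right (by norm_num)
  obtain ⟨K, s, hs, hK⟩ := h1.exists_lipschitzOnWith
  have hd : ∀ᶠ x in 𝓝 x₀, DifferentiableAt ℝ f x :=
    (hf.eventually (by simp)).mono fun x hx => hx.differentiableAt (by norm_num)
  obtain ⟨δ, hδ, hball⟩ := Metric.eventually_nhds_iff_ball.1 (hd.and hs)
  refine ⟨K, K.2, δ, hδ, fun p hp q hq => ?_⟩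
  have hseg : segment ℝ p q ⊆ Metric.ball x₀ δ := (convex_ball x₀ δ).segment_subset hp hq
  -- Mean value inequality for `f - f'(p)` on the segment, where the derivative differs from `f'(p)`
  -- by at most `K * ‖q - p‖`.
  have := Convex.norm_image_sub_le_of_norm_hasFDerivWithin_le' (f := f) (f' := fderiv ℝ f)
    (φ := fderiv ℝ f p) (C := K * ‖q - p‖) (s := segment ℝ p q) (x := p) (y := q)
    (fun x hx => (hball x (hseg hx)).1.hasFDerivAt.hasFDerivWithinAt)
    (fun x hx => by
      refine (hK.norm_sub_le (hball x (hseg hx)).2 (hball p hp).2).trans ?_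
      gcongr
      exact norm_sub_le_of_mem_segment hx)
    (convex_segment p q) (left_mem_segment ℝ p q) (right_mem_segment ℝ p q)
  linarith [this, sq (‖q - p‖), mul_assoc (K : ℝ) ‖q - p‖ ‖q - p‖]

theorem exists_norm_sub_le {f : F → G} {x₀ : F} (hf : ContDiffAt ℝ 1 f x₀) :
    ∃ K : ℝ, 0 ≤ K ∧ ∃ δ > 0, ∀ p ∈ Metric.ball x₀ δ, ∀ q ∈ Metric.ball x₀ δ,
      ‖f q - f p‖ ≤ K * ‖q - p‖ := by
  obtain ⟨K, s, hs, hK⟩ := hf.exists_lipschitzOnWith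
  obtain ⟨δ, hδ, hball⟩ := Metric.mem_nhds_iff.1 hs
  exact ⟨K, K.2, δ, hδ, fun p hp q hq => hK.norm_sub_le (hball hq) (hball hp)⟩

/-- A function with a local minimum does not have a negative second derivative there. -/
theorem deriv_deriv_nonneg_of_isLocalMin {f : ℝ → ℝ} {x : ℝ} (h : IsLocalMin f x)
    (hc : ContinuousAt f x) : 0 ≤ deriv (deriv f) x := by
  by_contra! hneg
  -- A negative second derivative would make `x` a local maximum too, so `f` would be locally
  -- constant.
  have hmax := isLocalMax_of_deriv_deriv_neg hneg h.deriv_eq_zero hc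
  have hconst : f =ᶠ[𝓝 x] fun _ => f x := by
    filter_upwards [h, hmax] with y h1 h2 using le_antisymm h2 h1
  have : deriv (deriv f) x = 0 := by
    rw [hconst.deriv.deriv_eq]
    simp
  linarith

/-- Quadratic growth from a lower bound of the second derivative, at a critical point. -/
theorem add_mul_sq_le_of_deriv2_ge {f f' f'' : ℝ → ℝ} {c : ℝ}
    (hf : ∀ r ∈ Set.Icc (0 : ℝ) 1, HasDerivAt f (f' r) r)
    (hf' : ∀ r ∈ Set.Icc (0 : ℝ) 1, HasDerivAt f' (f'' r) r)
    (hc : ∀ r ∈ Set.Icc (0 : ℝ) 1, 2 * c ≤ f'' r) (h0 : f' 0 = 0) :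
    f 0 + c ≤ f 1 := by
  -- Integrating twice by monotonicity: `f' r ≥ 2 * c * r`, hence `f r - c * r ^ 2` increases.
  have key : ∀ r ∈ Set.Icc (0 : ℝ) 1, 0 ≤ f' r - 2 * c * r := by
    have hm : MonotoneOn (fun r => f' r - 2 * c * r) (Set.Icc 0 1) := by
      have hd : ∀ r ∈ Set.Icc (0 : ℝ) 1,
          HasDerivAt (fun r => f' r - 2 * c * r) (f'' r - 2 * c) r := fun r hr => by
        refine ((hf' r hr).sub ((hasDerivAt_id r).const_mul (2 * c))).congr_deriv ?_
        simp
      refine monotoneOn_of_deriv_nonneg (convex_Icc 0 1)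
        (fun r hr => (hd r hr).continuousAt.continuousWithinAt)
        (fun r hr => (hd r (interior_subset hr)).differentiableAt.differentiableWithinAt)
        fun r hr => ?_
      rw [(hd r (interior_subset hr)).deriv]
      linarith [hc r (interior_subset hr)]
    intro r hr
    have := hm (Set.left_mem_Icc.2 zero_le_one) hr hr.1
    simpa [h0] using this
  have hd : ∀ r ∈ Set.Icc (0 : ℝ) 1,
      HasDerivAt (fun r => f r - c * r ^ 2) (f' r - 2 * c * r) r := fun r hr => by
    refine ((hf r hr).sub (((hasDerivAt_id r).pow 2).const_mul c)).congr_deriv ?_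
    simp
    ring
  have hm : MonotoneOn (fun r => f r - c * r ^ 2) (Set.Icc 0 1) := by
    refine monotoneOn_of_deriv_nonneg (convex_Icc 0 1)
      (fun r hr => (hd r hr).continuousAt.continuousWithinAt)
      (fun r hr => (hd r (interior_subset hr)).differentiableAt.differentiableWithinAt)
      fun r hr => ?_
    rw [(hd r (interior_subset hr)).deriv]
    exact key r (interior_subset hr)
  have := hm (Set.left_mem_Icc.2 zero_le_one) (Set.right_mem_Icc.2 zero_le_one) zero_le_one
  simp at this
  linarith

/-- The adjoint as a continuous linear map over the reals. -/
def adjointCLM (F G : Type*) [NormedAddCommGroup F] [InnerProductSpace ℝ F] [CompleteSpace F]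
    [NormedAddCommGroup G] [InnerProductSpace ℝ G] [CompleteSpace G] :
    (F →L[ℝ] G) →L[ℝ] (G →L[ℝ] F) :=
  LinearMap.mkContinuous
    { toFun := fun A => ContinuousLinearMap.adjoint A
      map_add' := fun A B => map_add _ A B
      map_smul' := fun r A => by simp }
    1 (fun A => by simp)

end Calculus

/-! ### Slice charts and the tangent space. -/

section Chart

variable {M : Set E} {V : Submodule ℝ E} {Φ : OpenPartialHomeomorph E E}

theorem IsSliceChart.contDiffAt (h : IsSliceChart M V Φ) {p : E} (hp : p ∈ Φ.source) :
    ContDiffAt ℝ (⊤ : ℕ∞) Φ p :=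
  (h.contDiffOn_toFun p hp).contDiffAt (Φ.open_source.mem_nhds hp)

theorem IsSliceChart.contDiffAt_symm (h : IsSliceChart M V Φ) {y : E} (hy : y ∈ Φ.target) :
    ContDiffAt ℝ (⊤ : ℕ∞) Φ.symm y :=
  (h.contDiffOn_symm y hy).contDiffAt (Φ.open_target.mem_nhds hy)

theorem IsSliceChart.hasFDerivAt (h : IsSliceChart M V Φ) {p : E} (hp : p ∈ Φ.source) :
    HasFDerivAt Φ (fderiv ℝ Φ p) p :=
  ((h.contDiffAt hp).differentiableAt (by simp)).hasFDerivAt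

theorem IsSliceChart.hasFDerivAt_symm (h : IsSliceChart M V Φ) {y : E} (hy : y ∈ Φ.target) :
    HasFDerivAt Φ.symm (fderiv ℝ Φ.symm y) y :=
  ((h.contDiffAt_symm hy).differentiableAt (by simp)).hasFDerivAt

theorem IsSliceChart.symm_mem_iff (h : IsSliceChart M V Φ) {y : E} (hy : y ∈ Φ.target) :
    Φ.symm y ∈ M ↔ y ∈ V := by
  rw [h.mem_iff _ (Φ.map_target hy), Φ.right_inv hy]

theorem IsSliceChart.fderiv_comp_fderiv_symm (h : IsSliceChart M V Φ) {p : E}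
    (hp : p ∈ Φ.source) (u : E) : fderiv ℝ Φ p (fderiv ℝ Φ.symm (Φ p) u) = u := by
  have hy := Φ.map_source hp
  have h1 : HasFDerivAt (Φ ∘ Φ.symm) (fderiv ℝ Φ p ∘L fderiv ℝ Φ.symm (Φ p)) (Φ p) := by
    refine HasFDerivAt.comp _ ?_ (h.hasFDerivAt_symm hy)
    rw [Φ.left_inv hp]
    exact h.hasFDerivAt hp
  have h2 : HasFDerivAt (Φ ∘ Φ.symm) (ContinuousLinearMap.id ℝ E) (Φ p) := by
    refine (hasFDerivAt_id (Φ p)).congr_of_eventuallyEq ?_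
    filter_upwards [Φ.open_target.mem_nhds hy] with y hy using Φ.right_inv hy
  exact congrArg (fun A : E →L[ℝ] E => A u) (h1.unique h2)

theorem IsSliceChart.fderiv_symm_injective (h : IsSliceChart M V Φ) {p : E}
    (hp : p ∈ Φ.source) : Function.Injective (fderiv ℝ Φ.symm (Φ p)) :=
  Function.LeftInverse.injective (h.fderiv_comp_fderiv_symm hp)

/-- The coordinate line through `Φ p` in the direction `u` gives a smooth curve. -/
theorem IsSliceChart.contDiffAt_line (h : IsSliceChart M V Φ) {p : E} (hp : p ∈ Φ.source)
    (u : E) : ContDiffAt ℝ (⊤ : ℕ∞) (fun r : ℝ => Φ.symm (Φ p + r • u)) 0 := by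
  refine ContDiffAt.comp (g := Φ.symm) (0 : ℝ) ?_ (by fun_prop)
  simpa using h.contDiffAt_symm (Φ.map_source hp)

theorem IsSliceChart.eventually_line_mem_target {p : E} (hp : p ∈ Φ.source)
    (u : E) : ∀ᶠ r : ℝ in 𝓝 0, Φ p + r • u ∈ Φ.target := by
  have : ContinuousAt (fun r : ℝ => Φ p + r • u) 0 := by fun_prop
  exact this.eventually (Φ.open_target.mem_nhds (by simpa using Φ.map_source hp))

theorem IsSliceChart.eventually_line_mem (h : IsSliceChart M V Φ) {p : E} (hp : p ∈ Φ.source)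
    (hpM : p ∈ M) {u : E} (hu : u ∈ V) : ∀ᶠ r : ℝ in 𝓝 0, Φ.symm (Φ p + r • u) ∈ M := by
  filter_upwards [eventually_line_mem_target hp u] with r hr
  exact (h.symm_mem_iff hr).2 (V.add_mem ((h.mem_iff p hp).1 hpM) (V.smul_mem r hu))

theorem hasDerivAt_line (a u : E) (r : ℝ) : HasDerivAt (fun r : ℝ => a + r • u) u r := by
  simpa using ((hasDerivAt_id r).smul_const u).const_add a

theorem IsSliceChart.hasDerivAt_line (h : IsSliceChart M V Φ) {p : E} (hp : p ∈ Φ.source)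
    (u : E) :
    HasDerivAt (fun r : ℝ => Φ.symm (Φ p + r • u)) (fderiv ℝ Φ.symm (Φ p) u) 0 := by
  refine HasFDerivAt.comp_hasDerivAt (0 : ℝ) (l := Φ.symm) ?_ (CutLocus.hasDerivAt_line (Φ p) u 0)
  simpa using h.hasFDerivAt_symm (Φ.map_source hp)

variable [FiniteDimensional ℝ E]

/-- The tangent space in a slice chart. -/
theorem IsSliceChart.tangentSpace_eq (h : IsSliceChart M V Φ) {p : E} (hp : p ∈ Φ.source)
    (hpM : p ∈ M) :
    tangentSpace M p = V.map (fderiv ℝ Φ.symm (Φ p) : E →ₗ[ℝ] E) := by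
  apply le_antisymm
  · refine Submodule.span_le.2 ?_
    rintro v ⟨γ, hγ, hγM, hγ0, rfl⟩
    have hγd : HasDerivAt γ (deriv γ 0) 0 := (hγ.differentiableAt (by simp)).hasDerivAt
    have hsrc : ∀ᶠ r in 𝓝 (0 : ℝ), γ r ∈ Φ.source :=
      hγ.continuousAt.eventually (Φ.open_source.mem_nhds (by rwa [hγ0]))
    have h1 : HasDerivAt (Φ ∘ γ) (fderiv ℝ Φ p (deriv γ 0)) 0 := by
      refine HasFDerivAt.comp_hasDerivAt (0 : ℝ) ?_ hγd
      rw [hγ0]; exact h.hasFDerivAt hp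
    -- The difference quotients of `Φ ∘ γ` lie in `V`, which is closed.
    have hw : fderiv ℝ Φ p (deriv γ 0) ∈ V := by
      have hcl : IsClosed (V : Set E) := V.closed_of_finiteDimensional
      have ht := hasDerivAt_iff_tendsto_slope.1 h1
      refine hcl.mem_of_tendsto ht ?_
      have : ∀ᶠ r in 𝓝 (0 : ℝ), slope (Φ ∘ γ) 0 r ∈ V := by
        filter_upwards [hsrc, hγM] with r h1 h2
        rw [slope_def_module]
        refine V.smul_mem _ (V.sub_mem ((h.mem_iff _ h1).1 h2) ?_)
        simpa [hγ0] using (h.mem_iff p hp).1 hpM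
      exact this.filter_mono nhdsWithin_le_nhds
    refine ⟨_, hw, ?_⟩
    have h2 : HasDerivAt (Φ.symm ∘ (Φ ∘ γ))
        (fderiv ℝ Φ.symm (Φ p) (fderiv ℝ Φ p (deriv γ 0))) 0 := by
      refine HasFDerivAt.comp_hasDerivAt (0 : ℝ) ?_ h1
      simp only [Function.comp, hγ0]
      exact h.hasFDerivAt_symm (Φ.map_source hp)
    have h3 : HasDerivAt (Φ.symm ∘ (Φ ∘ γ)) (deriv γ 0) 0 := by
      refine hγd.congr_of_eventuallyEq ?_
      filter_upwards [hsrc] with r hr using Φ.left_inv hr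
    exact h2.unique h3
  · rintro _ ⟨u, hu, rfl⟩
    refine Submodule.subset_span ⟨fun r => Φ.symm (Φ p + r • u), h.contDiffAt_line hp u,
      h.eventually_line_mem hp hpM hu, ?_, (h.hasDerivAt_line hp u).deriv⟩
    simp [Φ.left_inv hp]

theorem IsSubmanifold.finrank_tangentSpace {m : ℕ} (hM : IsSubmanifold m M) {p : E}
    (hp : p ∈ M) : Module.finrank ℝ (tangentSpace M p) = m := by
  obtain ⟨V, Φ, h, hps, hV⟩ := hM p hp
  rw [h.tangentSpace_eq hps hp, ← hV]
  exact (Submodule.equivMapOfInjective _ (h.fderiv_symm_injective hps) V).finrank_eq.symm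

end Chart

end CutLocus
end

noncomputable section

namespace CutLocus

variable {E : Type*} [NormedAddCommGroup E] [InnerProductSpace ℝ E]

/-! ### Smoothness of the tangential projection and the Weingarten mapping. -/

section TanProj

variable {M : Set E} {V : Submodule ℝ E} {Φ : OpenPartialHomeomorph E E}

theorem inner_eq_zero_of_mem {p v w : E} (hv : v ∈ (tangentSpace M p)ᗮ)
    (hw : w ∈ tangentSpace M p) : inner ℝ v w = 0 :=
  (Submodule.mem_orthogonal' _ _).1 hv w hw

/-- On tangent vectors, a derivative within `M` is the derivative of any extension. -/
theorem fderivWithin_apply_of_mem_tangentSpace {F : Type*} [NormedAddCommGroup F]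
    [NormedSpace ℝ F] {f g : E → F} {g' : E →L[ℝ] F} {p : E} (hpM : p ∈ M)
    (hg : HasFDerivAt g g' p) (hfg : ∀ᶠ q in 𝓝 p, q ∈ M → f q = g q) {w : E}
    (hw : w ∈ tangentSpace M p) : fderivWithin ℝ f M p w = g' w := by
  have hfg' : f =ᶠ[𝓝[M] p] g := eventually_nhdsWithin_iff.2 hfg
  have hf : HasFDerivWithinAt f (fderivWithin ℝ f M p) M p :=
    (hg.hasFDerivWithinAt.congr_of_eventuallyEq hfg' (hfg.self_of_nhds hpM)).differentiableWithinAt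
      |>.hasFDerivWithinAt
  -- A derivative within `M` is determined only in tangent directions; there it suffices to compare
  -- on velocities of curves.
  suffices tangentSpace M p ≤ LinearMap.eqLocus (fderivWithin ℝ f M p : E →ₗ[ℝ] F)
      (g' : E →ₗ[ℝ] F) from this hw
  refine Submodule.span_le.2 ?_
  rintro v ⟨γ, hγ, hγM, hγ0, rfl⟩
  have hγd : HasDerivAt γ (deriv γ 0) 0 := (hγ.differentiableAt (by simp)).hasDerivAt
  have h1 : HasDerivAt (f ∘ γ) (fderivWithin ℝ f M p (deriv γ 0)) 0 := by
    subst hγ0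
    have := HasFDerivWithinAt.comp_hasDerivWithinAt (s := γ ⁻¹' M) (0 : ℝ) hf
      hγd.hasDerivWithinAt (fun r hr => hr)
    exact this.hasDerivAt hγM
  have h2 : HasDerivAt (g ∘ γ) (g' (deriv γ 0)) 0 := by
    subst hγ0
    exact hg.comp_hasDerivAt _ hγd
  have h3 : f ∘ γ =ᶠ[𝓝 0] g ∘ γ := by
    subst hγ0
    filter_upwards [hγM, hγ.continuousAt.eventually hfg] with r hr h using h hr
  exact h1.unique (h2.congr_of_eventuallyEq h3)

variable [FiniteDimensional ℝ E]

theorem isUnit_adjoint_comp_self {F : Type*} [NormedAddCommGroup F] [InnerProductSpace ℝ F]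
    [FiniteDimensional ℝ F] {J : F →L[ℝ] E} (hJ : Function.Injective J) :
    IsUnit (ContinuousLinearMap.adjoint J ∘L J) := by
  rw [ContinuousLinearMap.isUnit_iff_bijective]
  have hinj : Function.Injective (ContinuousLinearMap.adjoint J ∘L J) := by
    refine (injective_iff_map_eq_zero _).2 fun u hu => ?_
    have : inner ℝ (J u) (J u) = 0 := by
      rw [← ContinuousLinearMap.adjoint_inner_left]
      simp only [ContinuousLinearMap.comp_apply] at hu
      simp [hu]
    exact (map_eq_zero_iff J hJ).1 (inner_self_eq_zero.1 this)
  exact ⟨hinj, (LinearMap.injective_iff_surjective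
    (f := (ContinuousLinearMap.adjoint J ∘L J : F →ₗ[ℝ] F))).1 hinj⟩

/-- The orthogonal projection onto the range of an injective map. -/
theorem starProjection_range_eq {F : Type*} [NormedAddCommGroup F] [InnerProductSpace ℝ F]
    [FiniteDimensional ℝ F] {J : F →L[ℝ] E} (hJ : Function.Injective J) {U : Submodule ℝ E}
    (hU : ∀ x, x ∈ U ↔ ∃ u, J u = x) :
    U.starProjection =
      J ∘L Ring.inverse (ContinuousLinearMap.adjoint J ∘L J) ∘L ContinuousLinearMap.adjoint J := by
  ext x
  have hu := isUnit_adjoint_comp_self hJ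
  refine Submodule.eq_starProjection_of_mem_of_inner_eq_zero ((hU _).2 ⟨_, rfl⟩) fun w hw => ?_
  obtain ⟨u, rfl⟩ := (hU _).1 hw
  rw [← ContinuousLinearMap.adjoint_inner_left, map_sub]
  have := congrArg (fun A : F →L[ℝ] F => A (ContinuousLinearMap.adjoint J x))
    (Ring.mul_inverse_cancel _ hu)
  simp only [mul_apply_eq_comp, ContinuousLinearMap.comp_apply,
    one_apply_eq_self] at this
  simp only [ContinuousLinearMap.comp_apply, this, sub_self, inner_zero_left]

/-- The projection onto the tangent spaces extends locally to a smooth map on the ambient space. -/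
theorem IsSliceChart.exists_contDiffAt_tanProj (h : IsSliceChart M V Φ) :
    ∃ T : E → E →L[ℝ] E, (∀ q ∈ Φ.source, ContDiffAt ℝ (⊤ : ℕ∞) T q) ∧
      ∀ q ∈ Φ.source, q ∈ M → T q = tanProj M q := by
  -- `J q` parametrizes the tangent space at `q ∈ M`, so `J (J* J)⁻¹ J*` is the projection onto it;
  -- the formula is smooth in `q`, also off `M`.
  let J : E → V →L[ℝ] E := fun q => fderiv ℝ Φ.symm (Φ q) ∘L V.subtypeL
  have hJinj : ∀ q ∈ Φ.source, Function.Injective (J q) := fun q hq =>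
    (h.fderiv_symm_injective hq).comp Subtype.val_injective
  have hJ : ∀ q ∈ Φ.source, ContDiffAt ℝ (⊤ : ℕ∞) J q := fun q hq => by
    have h1 : ContDiffAt ℝ (⊤ : ℕ∞) (fderiv ℝ Φ.symm) (Φ q) :=
      (h.contDiffAt_symm (Φ.map_source hq)).fderiv_right (by simp)
    have h2 : ContDiffAt ℝ (⊤ : ℕ∞) (fun q => fderiv ℝ Φ.symm (Φ q)) q :=
      h1.comp q (h.contDiffAt hq)
    exact h2.clm_comp contDiffAt_const
  refine ⟨fun q => J q ∘L Ring.inverse (ContinuousLinearMap.adjoint (J q) ∘L J q) ∘L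
    ContinuousLinearMap.adjoint (J q), fun q hq => ?_, fun q hq hqM => ?_⟩
  · have hadj : ContDiffAt ℝ (⊤ : ℕ∞) (fun q => ContinuousLinearMap.adjoint (J q)) q :=
      (adjointCLM V E).contDiff.contDiffAt.comp q (hJ q hq)
    have hcomp : ContDiffAt ℝ (⊤ : ℕ∞) (fun q => ContinuousLinearMap.adjoint (J q) ∘L J q) q :=
      hadj.clm_comp (hJ q hq)
    obtain ⟨w, hw⟩ := isUnit_adjoint_comp_self (hJinj q hq)
    have hinv : ContDiffAt ℝ (⊤ : ℕ∞)
        (fun q => Ring.inverse (ContinuousLinearMap.adjoint (J q) ∘L J q)) q := by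
      have := contDiffAt_ringInverse ℝ (n := (⊤ : ℕ∞)) w
      rw [hw] at this
      exact this.comp q hcomp
    exact (hJ q hq).clm_comp (hinv.clm_comp hadj)
  · refine (starProjection_range_eq (hJinj q hq) fun x => ?_).symm
    rw [h.tangentSpace_eq hq hqM]
    simp [J, Submodule.mem_map]

theorem tanProj_apply_mem (M : Set E) (p x : E) : tanProj M p x ∈ tangentSpace M p :=
  Submodule.starProjection_apply_mem _ _

theorem tanProj_eq_self {p x : E} (hx : x ∈ tangentSpace M p) : tanProj M p x = x :=
  Submodule.starProjection_eq_self_iff.2 hx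

theorem tanProj_eq_zero {p x : E} (hx : x ∈ (tangentSpace M p)ᗮ) : tanProj M p x = 0 :=
  (Submodule.starProjection_apply_eq_zero_iff _).2 hx

theorem norm_tanProj_le (M : Set E) (p : E) : ‖tanProj M p‖ ≤ 1 :=
  Submodule.starProjection_norm_le _

theorem inner_tanProj_left (M : Set E) (p x y : E) :
    inner ℝ (tanProj M p x) y = inner ℝ x (tanProj M p y) :=
  Submodule.inner_starProjection_left_eq_right _ _ _

/-- The Weingarten mapping in terms of a smooth extension of the tangential projections. -/
theorem weingarten_apply_eq {T : E → E →L[ℝ] E} {T' : E →L[ℝ] E →L[ℝ] E} {p : E} (hpM : p ∈ M)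
    (hT : HasFDerivAt T T' p) (hTM : ∀ᶠ q in 𝓝 p, q ∈ M → T q = tanProj M q) (ν : E)
    (w : tangentSpace M p) : (weingarten M p ν w : E) = tanProj M p (T' w ν) := by
  have hd : HasFDerivAt (fun q => ν - T q ν) (-(T'.flip ν)) p := by
    refine ((hasFDerivAt_const ν p).sub (hT.clm_apply (hasFDerivAt_const ν p))).congr_fderiv ?_
    ext; simp
  have := fderivWithin_apply_of_mem_tangentSpace (f := fun α => norProj M α ν) hpM hd
    (by filter_upwards [hTM] with q hq hqM; simp [norProj, hq hqM]) w.2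
  simp only [weingarten, neg_apply, ContinuousLinearMap.comp_apply,
    Submodule.subtypeL_apply, this, map_neg, neg_neg, ContinuousLinearMap.flip_apply]
  rfl

end TanProj

end CutLocus
end

noncomputable section

namespace CutLocus

variable {E : Type*} [NormedAddCommGroup E] [InnerProductSpace ℝ E]

/-! ### Uniform estimates for pairs of points of `M`; symmetry of the Weingarten mapping. -/

section Bounds

variable {M : Set E} {V : Submodule ℝ E} {Φ : OpenPartialHomeomorph E E}

/-- Maps that agree on `M` have the same derivative along `M`. -/
theorem fderiv_eq_of_mem_tangentSpace {F : Type*} [NormedAddCommGroup F]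
    [NormedSpace ℝ F] {f g : E → F} {f' g' : E →L[ℝ] F} {p : E} (hpM : p ∈ M)
    (hf : HasFDerivAt f f' p) (hg : HasFDerivAt g g' p) (hfg : ∀ᶠ q in 𝓝 p, q ∈ M → f q = g q)
    {w : E} (hw : w ∈ tangentSpace M p) : f' w = g' w := by
  rw [← fderivWithin_apply_of_mem_tangentSpace hpM hg hfg hw,
    fderivWithin_apply_of_mem_tangentSpace hpM hf (.of_forall fun _ _ => rfl) hw]

theorem two_le_top : (2 : WithTop ℕ∞) ≤ ((⊤ : ℕ∞) : WithTop ℕ∞) :=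
  WithTop.coe_le_coe.2 le_top

variable [FiniteDimensional ℝ E]

theorem norm_sub_tanProj_le (M : Set E) (p x : E) : ‖x - tanProj M p x‖ ≤ ‖x‖ := by
  have h := Submodule.starProjection_add_starProjection_orthogonal (K := tangentSpace M p) x
  have : x - tanProj M p x = (tangentSpace M p)ᗮ.starProjection x := by
    rw [sub_eq_iff_eq_add', tanProj, h]
  rw [this]
  exact Submodule.norm_starProjection_apply_le _ _

theorem norm_sub_tanProj_le_of_mem {p w : E} (x : E) (hw : w ∈ tangentSpace M p) :
    ‖x - tanProj M p x‖ ≤ ‖x - w‖ := by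
  have := norm_sub_tanProj_le M p (x - w)
  rwa [map_sub, tanProj_eq_self hw, sub_sub_sub_cancel_right] at this

theorem norm_tanProj_apply_le (M : Set E) (p x : E) : ‖tanProj M p x‖ ≤ ‖x‖ :=
  Submodule.norm_starProjection_apply_le _ _

theorem tanProj_idem (M : Set E) (p : E) : tanProj M p ∘L tanProj M p = tanProj M p := by
  ext x
  exact tanProj_eq_self (tanProj_apply_mem M p x)

/-- The derivative of the tangential projection maps normal vectors to tangent vectors. -/
theorem tanProj_fderiv_apply {T : E → E →L[ℝ] E} {T' : E →L[ℝ] E →L[ℝ] E} {p : E} (hpM : p ∈ M)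
    (hT : HasFDerivAt T T' p) (hTM : ∀ᶠ q in 𝓝 p, q ∈ M → T q = tanProj M q) {ν w : E}
    (hν : ν ∈ (tangentSpace M p)ᗮ) (hw : w ∈ tangentSpace M p) :
    tanProj M p (T' w ν) = T' w ν := by
  -- Differentiating `T ∘ T = T` along `M` gives `T' T + T T' = T'`; on a normal vector the first
  -- term vanishes.
  have h1 := hT.clm_comp hT
  have h2 := fderiv_eq_of_mem_tangentSpace hpM h1 hT
    (by filter_upwards [hTM] with q hq hqM; rw [hq hqM, tanProj_idem]) hw
  have h3 := congrArg (fun A : E →L[ℝ] E => A ν) h2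
  simpa [hTM.self_of_nhds hpM, tanProj_eq_zero hν] using h3

/-- The Weingarten mapping composed with the tangential projection, on the ambient space. -/
def shape (M : Set E) (p ν : E) : E →L[ℝ] E :=
  (tangentSpace M p).subtypeL ∘L weingarten M p ν ∘L (tangentSpace M p).orthogonalProjectionOnto

theorem shape_apply_eq {T : E → E →L[ℝ] E} {T' : E →L[ℝ] E →L[ℝ] E} {p : E} (hpM : p ∈ M)
    (hT : HasFDerivAt T T' p) (hTM : ∀ᶠ q in 𝓝 p, q ∈ M → T q = tanProj M q) (ν x : E) :
    shape M p ν x = tanProj M p (T' (tanProj M p x) ν) :=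
  weingarten_apply_eq hpM hT hTM ν _

/-- Because `tan + nor = I`, this puts `G` in the form in which the foot point expansion is stated.
-/
theorem stabilizer_apply (M : Set E) (t x : E) :
    stabilizer M t x = x - shape M (nearestPoint M t) (t - nearestPoint M t) x := by
  have h1 : ∀ p, ((tangentSpace M p).orthogonalProjectionOnto x : E) = tanProj M p x :=
    fun _ => rfl
  simp only [stabilizer, shape, norProj, add_apply,
    ContinuousLinearMap.comp_apply, sub_apply, map_sub,
    ContinuousLinearMap.id_apply, Submodule.subtypeL_apply, h1]
  abel

/-- The first and second order estimates for a pair of points of `M` that are used below. -/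
structure PairBound (M : Set E) (K : ℝ) (p q : E) : Prop where
  norm_nor_le : ‖q - p - tanProj M p (q - p)‖ ≤ K * ‖q - p‖ ^ 2
  norm_tan_sub_le : ‖tanProj M q - tanProj M p‖ ≤ K * ‖q - p‖
  norm_tan_sub_shape_le : ∀ ν ∈ (tangentSpace M p)ᗮ,
    ‖tanProj M q ν - shape M p ν (q - p)‖ ≤ K * ‖q - p‖ ^ 2 * ‖ν‖

theorem PairBound.mono {K K' : ℝ} {p q : E} (h : PairBound M K p q) (hK : K ≤ K') :
    PairBound M K' p q where
  norm_nor_le := h.norm_nor_le.trans (by gcongr)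
  norm_tan_sub_le := h.norm_tan_sub_le.trans (by gcongr)
  norm_tan_sub_shape_le ν hν := (h.norm_tan_sub_shape_le ν hν).trans (by gcongr)

/-- In the chart `M` is flat: up to second order `q - p` is the image of `Φ q - Φ p ∈ V`, hence
tangent at `p`. The other bounds come from Taylor expansion of a smooth extension `T` of the
projection, whose derivative at a normal vector is `shape`. All constants hold on a common ball. -/
theorem IsSliceChart.exists_pairBound (h : IsSliceChart M V Φ) {x₀ : E} (hx₀ : x₀ ∈ Φ.source) :
    ∃ K : ℝ, 0 ≤ K ∧ ∃ δ > 0, ∀ p ∈ Metric.ball x₀ δ, p ∈ M →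
      (∀ ν x, ‖shape M p ν x‖ ≤ K * ‖ν‖ * ‖x‖) ∧
      ∀ q ∈ Metric.ball x₀ δ, q ∈ M → PairBound M K p q := by
  obtain ⟨T, hTd, hTM⟩ := h.exists_contDiffAt_tanProj
  have hT0 := hTd x₀ hx₀
  obtain ⟨K₁, hK₁, δ₁, hδ₁, h₁⟩ := exists_norm_sub_sub_fderiv_le (hT0.of_le two_le_top)
  obtain ⟨K₂, hK₂, δ₂, hδ₂, h₂⟩ := exists_norm_sub_le (hT0.of_le (by exact_mod_cast le_top))
  have hy₀ := Φ.map_source hx₀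
  obtain ⟨K₃, hK₃, δ₃, hδ₃, h₃⟩ := exists_norm_sub_sub_fderiv_le
    ((h.contDiffAt_symm hy₀).of_le two_le_top)
  obtain ⟨K₄, hK₄, δ₄, hδ₄, h₄⟩ := exists_norm_sub_le
    ((h.contDiffAt hx₀).of_le (by exact_mod_cast le_top))
  have hT'c : ContinuousAt (fderiv ℝ T) x₀ :=
    (hT0.fderiv_right (m := 0) (by simp)).continuousAt
  set K₅ := ‖fderiv ℝ T x₀‖ + 1 with hK₅
  have h₅ : ∀ᶠ p in 𝓝 x₀, ‖fderiv ℝ T p‖ < K₅ := by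
    have := (continuous_norm (E := E →L[ℝ] E →L[ℝ] E)).continuousAt.comp hT'c
    exact this.eventually_lt_const (by simp [hK₅])
  have h₆ : ∀ᶠ p in 𝓝 x₀, Φ p ∈ Metric.ball (Φ x₀) δ₃ :=
    (Φ.continuousAt hx₀).eventually (Metric.ball_mem_nhds _ hδ₃)
  obtain ⟨δ, hδ, hball⟩ := Metric.eventually_nhds_iff_ball.1
    ((((h₅.and h₆).and (Metric.ball_mem_nhds _ hδ₁)).and (Metric.ball_mem_nhds _ hδ₂)).and
      (Eventually.and (Metric.ball_mem_nhds _ hδ₄) (Φ.open_source.mem_nhds hx₀)))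
  set K₇ := K₃ * K₄ ^ 2
  have hK₇ : 0 ≤ K₇ := by positivity
  have hK₅0 : 0 ≤ K₅ := by positivity
  refine ⟨K₁ + K₂ + K₅ + K₇ + K₅ * K₇, by positivity, δ, hδ, fun p hp hpM => ?_⟩
  obtain ⟨⟨⟨⟨p5, p6⟩, p1⟩, p2⟩, p4, ps⟩ := hball p hp
  have hTp : HasFDerivAt T (fderiv ℝ T p) p := ((hTd p ps).differentiableAt (by simp)).hasFDerivAt
  have hTMp : ∀ᶠ q in 𝓝 p, q ∈ M → T q = tanProj M q := by
    filter_upwards [Φ.open_source.mem_nhds ps] with q hq hqM using hTM q hq hqM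
  have hT'le : ∀ v ν, ‖fderiv ℝ T p v ν‖ ≤ K₅ * ‖v‖ * ‖ν‖ := fun v ν =>
    (ContinuousLinearMap.le_opNorm₂ _ _ _).trans (by gcongr)
  constructor
  · intro ν x
    rw [shape_apply_eq hpM hTp hTMp]
    calc _ ≤ K₅ * ‖tanProj M p x‖ * ‖ν‖ := (norm_tanProj_apply_le _ _ _).trans (hT'le _ _)
      _ ≤ K₅ * ‖x‖ * ‖ν‖ := by gcongr; exact norm_tanProj_apply_le _ _ _
      _ = K₅ * ‖ν‖ * ‖x‖ := by ring
      _ ≤ _ := by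
        gcongr
        have : 0 ≤ K₅ * K₇ := by positivity
        linarith
  intro q hq hqM
  obtain ⟨⟨⟨⟨q5, q6⟩, q1⟩, q2⟩, q4, qs⟩ := hball q hq
  have hnor : ‖q - p - tanProj M p (q - p)‖ ≤ K₇ * ‖q - p‖ ^ 2 := by
    have hmem : fderiv ℝ Φ.symm (Φ p) (Φ q - Φ p) ∈ tangentSpace M p := by
      rw [h.tangentSpace_eq ps hpM]
      exact Submodule.mem_map_of_mem (V.sub_mem ((h.mem_iff q qs).1 hqM) ((h.mem_iff p ps).1 hpM))
    refine (norm_sub_tanProj_le_of_mem _ hmem).trans ?_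
    have := h₃ _ p6 _ q6
    rw [Φ.left_inv ps, Φ.left_inv qs] at this
    refine this.trans ?_
    have h4 := h₄ p p4 q q4
    calc _ ≤ K₃ * (K₄ * ‖q - p‖) ^ 2 := by gcongr
      _ = _ := by simp only [K₇]; ring
  have htan : ‖tanProj M q - tanProj M p‖ ≤ K₂ * ‖q - p‖ := by
    rw [← hTM q qs hqM, ← hTM p ps hpM]
    exact h₂ p p2 q q2
  refine ⟨hnor.trans ?_, htan.trans ?_, fun ν hν => ?_⟩
  · gcongr
    have : 0 ≤ K₅ * K₇ := by positivity
    linarith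
  · gcongr
    have : 0 ≤ K₅ * K₇ := by positivity
    linarith
  · rw [shape_apply_eq hpM hTp hTMp,
      tanProj_fderiv_apply hpM hTp hTMp hν (tanProj_apply_mem _ _ _)]
    -- Taylor error of `T`, plus the error from replacing `q - p` by its tangential part; the latter
    -- is of second order by `hnor`.
    have e : tanProj M q ν - fderiv ℝ T p (tanProj M p (q - p)) ν =
        (T q - T p - fderiv ℝ T p (q - p)) ν +
          fderiv ℝ T p (q - p - tanProj M p (q - p)) ν := by
      rw [hTM q qs hqM, hTM p ps hpM, map_sub (fderiv ℝ T p) (q - p)]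
      simp [tanProj_eq_zero hν]
    rw [e]
    calc _ ≤ ‖T q - T p - fderiv ℝ T p (q - p)‖ * ‖ν‖ +
          K₅ * ‖q - p - tanProj M p (q - p)‖ * ‖ν‖ :=
        (norm_add_le _ _).trans (add_le_add (ContinuousLinearMap.le_opNorm _ _) (hT'le _ _))
      _ ≤ K₁ * ‖q - p‖ ^ 2 * ‖ν‖ + K₅ * (K₇ * ‖q - p‖ ^ 2) * ‖ν‖ := by
        gcongr
        exact h₁ p p1 q q1
      _ = (K₁ + K₅ * K₇) * ‖q - p‖ ^ 2 * ‖ν‖ := by ring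
      _ ≤ _ := by
        gcongr
        linarith

/-- The estimates `PairBound` hold uniformly on a compact submanifold. -/
theorem IsSubmanifold.exists_pairBound {m : ℕ} (hM : IsSubmanifold m M) (hc : IsCompact M) :
    ∃ K : ℝ, 0 ≤ K ∧ ∀ p ∈ M, ∀ q ∈ M, PairBound M K p q := by
  suffices ∃ K : ℝ, 0 ≤ K ∧ ∀ z ∈ M ×ˢ M, z.1 ∈ M → z.2 ∈ M → PairBound M K z.1 z.2 by
    obtain ⟨K, hK, h⟩ := this
    exact ⟨K, hK, fun p hp q hq => h (p, q) ⟨hp, hq⟩ hp hq⟩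
  -- Near a diagonal point of `M ×ˢ M` a single chart gives the bounds. Away from the diagonal `‖q -
  -- p‖` is bounded below, so crude bounds suffice.
  refine (hc.prod hc).induction_on
    (p := fun s => ∃ K : ℝ, 0 ≤ K ∧ ∀ z ∈ s, z.1 ∈ M → z.2 ∈ M → PairBound M K z.1 z.2)
    ⟨0, le_rfl, by simp⟩ ?_ ?_ ?_
  · rintro s t hst ⟨K, hK, h⟩
    exact ⟨K, hK, fun z hz => h z (hst hz)⟩
  · rintro s t ⟨K, hK, h⟩ ⟨K', hK', h'⟩
    refine ⟨max K K', le_max_of_le_left hK, fun z hz h1 h2 => ?_⟩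
    rcases hz with hz | hz
    · exact (h z hz h1 h2).mono (le_max_left _ _)
    · exact (h' z hz h1 h2).mono (le_max_right _ _)
  · rintro ⟨p₀, q₀⟩ ⟨hp₀, hq₀⟩
    obtain ⟨V, Φ, h, hps, -⟩ := hM p₀ hp₀
    obtain ⟨K, hK, δ, hδ, hb⟩ := h.exists_pairBound hps
    by_cases hpq : p₀ = q₀
    · subst hpq
      refine ⟨Metric.ball p₀ δ ×ˢ Metric.ball p₀ δ, mem_nhdsWithin_of_mem_nhds
        (prod_mem_nhds (Metric.ball_mem_nhds _ hδ) (Metric.ball_mem_nhds _ hδ)), K, hK, ?_⟩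
      exact fun z hz h1 h2 => (hb z.1 hz.1 h1).2 z.2 hz.2 h2
    -- With a third of the distance as radius, points of the two balls remain at least `e` apart, so
    -- factors `‖q - p‖ / e ≥ 1` may be inserted freely.
    · obtain ⟨e, he, hne⟩ : ∃ e > 0, 3 * e = dist p₀ q₀ :=
        ⟨dist p₀ q₀ / 3, by have := dist_pos.2 hpq; positivity, by ring⟩
      refine ⟨Metric.ball p₀ (min δ e) ×ˢ Metric.ball q₀ e, mem_nhdsWithin_of_mem_nhds
        (prod_mem_nhds (Metric.ball_mem_nhds _ (lt_min hδ he)) (Metric.ball_mem_nhds _ he)),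
        2 / e + (1 / e ^ 2 + K / e), by positivity, ?_⟩
      rintro ⟨p, q⟩ ⟨hp, hq⟩ hpM hqM
      have hsh := (hb p (Metric.ball_subset_ball (min_le_left _ _) hp) hpM).1
      have hp' : dist p p₀ < e := (Metric.mem_ball.1 hp).trans_le (min_le_right _ _)
      have hq' : dist q q₀ < e := hq
      have hd : e ≤ ‖q - p‖ := by
        rw [← dist_eq_norm]
        have := dist_triangle4 p₀ p q q₀
        rw [dist_comm p₀ p, dist_comm p q] at this
        linarith
      have h1 : 1 ≤ ‖q - p‖ / e := (one_le_div he).2 hd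
      dsimp only
      refine ⟨(norm_sub_tanProj_le _ _ _).trans ?_, ?_, fun ν hν => ?_⟩
      · calc ‖q - p‖ ≤ ‖q - p‖ * (‖q - p‖ / e) := le_mul_of_one_le_right (norm_nonneg _) h1
          _ = 1 / e * ‖q - p‖ ^ 2 := by ring
          _ ≤ _ := by
            gcongr
            have : 1 / e ≤ 2 / e := by gcongr; norm_num
            have : 0 ≤ 1 / e ^ 2 + K / e := by positivity
            linarith
      · calc _ ≤ 2 := by
              linarith [norm_sub_le (tanProj M q) (tanProj M p), norm_tanProj_le M p,
                norm_tanProj_le M q]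
          _ ≤ 2 * (‖q - p‖ / e) := by linarith
          _ = 2 / e * ‖q - p‖ := by ring
          _ ≤ _ := by
            gcongr
            have : 0 ≤ 1 / e ^ 2 + K / e := by positivity
            linarith
      · calc _ ≤ ‖ν‖ + K * ‖ν‖ * ‖q - p‖ :=
              (norm_sub_le _ _).trans (add_le_add (norm_tanProj_apply_le _ _ _) (hsh _ _))
          _ ≤ ‖ν‖ * (‖q - p‖ / e) ^ 2 + K * ‖ν‖ * ‖q - p‖ * (‖q - p‖ / e) := by
            exact add_le_add (le_mul_of_one_le_right (norm_nonneg _) (one_le_pow₀ h1))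
              (le_mul_of_one_le_right (by positivity) h1)
          _ = (1 / e ^ 2 + K / e) * ‖q - p‖ ^ 2 * ‖ν‖ := by ring
          _ ≤ _ := by
            refine mul_le_mul_of_nonneg_right (mul_le_mul_of_nonneg_right ?_ (by positivity))
              (norm_nonneg _)
            have : 0 ≤ 2 / e := by positivity
            linarith

/-- First order expansion of the foot point of a normal vector. -/
theorem PairBound.norm_remainder_le {K : ℝ} {p q t t' : E} (h : PairBound M K p q)
    (ht : t - p ∈ (tangentSpace M p)ᗮ) (ht' : t' - q ∈ (tangentSpace M q)ᗮ) :
    ‖q - p - shape M p (t - p) (q - p) - tanProj M p (t' - t)‖ ≤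
      K * ‖q - p‖ ^ 2 * (2 + ‖t - p‖) + K * ‖q - p‖ * ‖t' - t‖ := by
  -- Rearranges `tan_q (t' - q) = 0` with `t' - q = (t' - t) + (t - p) - (q - p)`, using also `tan_p
  -- (t - p) = 0`.
  have e : q - p - shape M p (t - p) (q - p) - tanProj M p (t' - t) =
      (q - p - tanProj M p (q - p)) + (tanProj M q (t - p) - shape M p (t - p) (q - p)) +
        ((tanProj M q - tanProj M p) (t' - t) - (tanProj M q - tanProj M p) (q - p)) := by
    have h1 := tanProj_eq_zero ht
    have h2 := tanProj_eq_zero ht'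
    have h3 : t' - t = (t' - q) + (q - p) - (t - p) := by abel
    simp only [h3, map_add, map_sub _ _ (t - p), sub_apply, h1, h2]
    abel
  rw [e]
  have h4 := (tanProj M q - tanProj M p).le_of_opNorm_le h.norm_tan_sub_le (t' - t)
  have h5 := (tanProj M q - tanProj M p).le_of_opNorm_le h.norm_tan_sub_le (q - p)
  calc _ ≤ ‖q - p - tanProj M p (q - p)‖ + ‖tanProj M q (t - p) - shape M p (t - p) (q - p)‖ +
        (‖(tanProj M q - tanProj M p) (t' - t)‖ + ‖(tanProj M q - tanProj M p) (q - p)‖) :=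
      (norm_add_le _ _).trans (add_le_add (norm_add_le _ _) (norm_sub_le _ _))
    _ ≤ K * ‖q - p‖ ^ 2 + K * ‖q - p‖ ^ 2 * ‖t - p‖ +
        (K * ‖q - p‖ * ‖t' - t‖ + K * ‖q - p‖ * ‖q - p‖) :=
      add_le_add (add_le_add h.norm_nor_le (h.norm_tan_sub_shape_le _ ht)) (add_le_add h4 h5)
    _ = _ := by ring

/-- The Weingarten mapping of a normal vector is symmetric. -/
theorem IsSliceChart.inner_shape_left (h : IsSliceChart M V Φ) {p : E} (ps : p ∈ Φ.source)
    (hpM : p ∈ M) {ν : E} (hν : ν ∈ (tangentSpace M p)ᗮ) (x y : E) :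
    inner ℝ (shape M p ν x) y = inner ℝ x (shape M p ν y) := by
  obtain ⟨T, hTd, hTM⟩ := h.exists_contDiffAt_tanProj
  have hTp : HasFDerivAt T (fderiv ℝ T p) p := ((hTd p ps).differentiableAt (by simp)).hasFDerivAt
  have hTMp : ∀ᶠ q in 𝓝 p, q ∈ M → T q = tanProj M q := by
    filter_upwards [Φ.open_source.mem_nhds ps] with q hq hqM using hTM q hq hqM
  have hy := Φ.map_source ps
  -- The projections are self-adjoint at points of `M`, so their derivatives in tangent directions
  -- are too.
  have hselfadj : ∀ w ∈ tangentSpace M p, ∀ a b : E,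
      inner ℝ (fderiv ℝ T p w a) b = inner ℝ a (fderiv ℝ T p w b) := by
    intro w hw a b
    have h1 : HasFDerivAt (fun q => inner ℝ b (T q a))
        ((innerSL ℝ b) ∘L ((fderiv ℝ T p).flip a)) p := by
      refine ((innerSL ℝ b).hasFDerivAt.comp p
        (hTp.clm_apply (hasFDerivAt_const a p))).congr_fderiv ?_
      ext; simp
    have h2 : HasFDerivAt (fun q => inner ℝ a (T q b))
        ((innerSL ℝ a) ∘L ((fderiv ℝ T p).flip b)) p := by
      refine ((innerSL ℝ a).hasFDerivAt.comp p
        (hTp.clm_apply (hasFDerivAt_const b p))).congr_fderiv ?_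
      ext; simp
    have := fderiv_eq_of_mem_tangentSpace hpM h1 h2 (by
      filter_upwards [hTMp] with q hq hqM
      rw [hq hqM, ← inner_tanProj_left, real_inner_comm]) hw
    rw [real_inner_comm]
    simpa using this
  set D := fderiv ℝ Φ.symm with hD
  have hDd : HasFDerivAt D (fderiv ℝ D (Φ p)) (Φ p) :=
    (((h.contDiffAt_symm hy).fderiv_right (m := (⊤ : ℕ∞))
      (by simp)).differentiableAt (by simp)).hasFDerivAt
  have hsymm : ∀ u v, fderiv ℝ D (Φ p) u v = fderiv ℝ D (Φ p) v u := by
    have := (h.contDiffAt_symm hy).isSymmSndFDerivAt (by simpa using two_le_top)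
    exact fun u v => this.eq u v
  -- Second fundamental form: differentiate `T (D v) = D v` along a coordinate line in `M` and pair
  -- with `ν`, which kills the tangential term. The right-hand side is symmetric in `u` and `v`.
  have hII : ∀ u ∈ V, ∀ v, v ∈ V → inner ℝ ν (fderiv ℝ T p (D (Φ p) u) (D (Φ p) v)) =
      inner ℝ ν (fderiv ℝ D (Φ p) u v) := by
    intro u hu v hv
    have hl : HasDerivAt (fun r : ℝ => D (Φ p + r • u) v) (fderiv ℝ D (Φ p) u v) 0 := by
      have h0 : HasFDerivAt D (fderiv ℝ D (Φ p)) (Φ p + (0 : ℝ) • u) := by simpa using hDd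
      have := h0.comp_hasDerivAt (0 : ℝ) (CutLocus.hasDerivAt_line (Φ p) u 0)
      simpa using this.clm_apply (hasDerivAt_const (0 : ℝ) v)
    have hc : HasDerivAt (fun r : ℝ => T (Φ.symm (Φ p + r • u)))
        (fderiv ℝ T p (D (Φ p) u)) 0 := by
      refine HasFDerivAt.comp_hasDerivAt (0 : ℝ) (l := T) ?_ (h.hasDerivAt_line ps u)
      simpa [Φ.left_inv ps] using hTp
    have hcl := hc.clm_apply hl
    have heq : (fun r : ℝ => T (Φ.symm (Φ p + r • u)) (D (Φ p + r • u) v)) =ᶠ[𝓝 0]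
        fun r : ℝ => D (Φ p + r • u) v := by
      filter_upwards [eventually_line_mem_target ps u, h.eventually_line_mem ps hpM hu] with r hr hrM
      rw [hTM _ (Φ.map_target hr) hrM]
      refine tanProj_eq_self ?_
      rw [h.tangentSpace_eq (Φ.map_target hr) hrM, Φ.right_inv hr]
      exact Submodule.mem_map_of_mem hv
    have := hcl.unique (hl.congr_of_eventuallyEq heq)
    simp only [zero_smul, add_zero, Φ.left_inv ps, hTM p ps hpM] at this
    rw [← this, inner_add_right, inner_eq_zero_of_mem hν (tanProj_apply_mem _ _ _), add_zero]
  have hsymII : ∀ w ∈ tangentSpace M p, ∀ w' ∈ tangentSpace M p,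
      inner ℝ ν (fderiv ℝ T p w w') = inner ℝ ν (fderiv ℝ T p w' w) := by
    intro w hw w' hw'
    rw [h.tangentSpace_eq ps hpM] at hw hw'
    obtain ⟨u, hu, rfl⟩ := hw
    obtain ⟨v, hv, rfl⟩ := hw'
    have h1 := hII u hu v hv
    have h2 := hII v hv u hu
    rw [hsymm] at h1
    exact h1.trans h2.symm
  have hx := tanProj_apply_mem M p x
  have hy' := tanProj_apply_mem M p y
  rw [shape_apply_eq hpM hTp hTMp, shape_apply_eq hpM hTp hTMp, inner_tanProj_left,
    ← inner_tanProj_left M p x, hselfadj _ hx, hsymII _ hx _ hy', ← hselfadj _ hy',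
    real_inner_comm]

end Bounds

end CutLocus
end

noncomputable section

namespace CutLocus

variable {E : Type*} [NormedAddCommGroup E] [InnerProductSpace ℝ E]

/-! ### Nearest points, quadratic growth, and its stability under perturbation. -/

section QuadGrowth

variable {M : Set E} {V : Submodule ℝ E} {Φ : OpenPartialHomeomorph E E}

theorem norm_sub_sq_eq (q p x : E) :
    ‖q - x‖ ^ 2 = ‖p - x‖ ^ 2 + ‖q - p‖ ^ 2 - 2 * inner ℝ (q - p) (x - p) := by
  have h1 : q - x = (q - p) - (x - p) := by abel
  rw [h1, norm_sub_sq_real, norm_sub_rev p x]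
  ring

/-- Expanding the square cancels the quadratic terms in `x`, leaving a condition affine in `x`; this
is what makes it tractable along rays from `p`. -/
theorem isNearestPoint_iff {x p : E} :
    IsNearestPoint M x p ↔ p ∈ M ∧ ∀ q ∈ M, 2 * inner ℝ (q - p) (x - p) ≤ ‖q - p‖ ^ 2 := by
  refine and_congr_right fun _ => forall₂_congr fun q _ => ?_
  rw [norm_sub_sq_eq q p x]
  constructor <;> intro h <;> linarith

/-- The squared distance to `x` on `M` grows quadratically away from `p`. -/
def QuadGrowth (M : Set E) (c : ℝ) (x p : E) : Prop :=
  p ∈ M ∧ ∀ q ∈ M, ‖p - x‖ ^ 2 + c * ‖q - p‖ ^ 2 ≤ ‖q - x‖ ^ 2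

theorem QuadGrowth.isNearestPoint {c : ℝ} {x p : E} (h : QuadGrowth M c x p) (hc : 0 ≤ c) :
    IsNearestPoint M x p :=
  ⟨h.1, fun q hq => le_trans (by nlinarith [sq_nonneg ‖q - p‖]) (h.2 q hq)⟩

theorem QuadGrowth.eq {c : ℝ} {x p q : E} (h : QuadGrowth M c x p) (hc : 0 < c)
    (hq : IsNearestPoint M x q) : q = p := by
  have h1 := h.2 q hq.1
  have h2 := hq.2 p h.1
  have h3 : ‖q - p‖ ^ 2 ≤ 0 := by
    by_contra! h0
    nlinarith
  have : ‖q - p‖ = 0 := pow_eq_zero_iff (two_ne_zero) |>.1 (le_antisymm h3 (sq_nonneg _))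
  exact sub_eq_zero.1 (norm_eq_zero.1 this)

theorem exists_isNearestPoint (hc : IsCompact M) (hne : M.Nonempty) (x : E) :
    ∃ p, IsNearestPoint M x p := by
  obtain ⟨p, hp, h⟩ := hc.exists_isMinOn hne (f := fun q => ‖q - x‖ ^ 2) (by fun_prop)
  exact ⟨p, hp, fun q hq => h hq⟩

theorem isNearestPoint_nearestPoint {x : E} (h : ∃ p, IsNearestPoint M x p) :
    IsNearestPoint M x (nearestPoint M x) :=
  Classical.epsilon_spec h

theorem existsUnique_of_notMem_cutlocus {x : E} (hx : x ∉ cutlocus M) :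
    ∃! p, IsNearestPoint M x p := by
  by_contra h
  exact hx (Or.inl h)

theorem isNearestPoint_of_notMem_cutlocus {x : E} (hx : x ∉ cutlocus M) :
    IsNearestPoint M x (nearestPoint M x) :=
  isNearestPoint_nearestPoint (existsUnique_of_notMem_cutlocus hx).exists

theorem eq_nearestPoint {x p : E} (hx : x ∉ cutlocus M) (hp : IsNearestPoint M x p) :
    p = nearestPoint M x :=
  (existsUnique_of_notMem_cutlocus hx).unique hp (isNearestPoint_of_notMem_cutlocus hx)

/-- A vector whose inner product with `q - p`, `q ∈ M`, is of second order is normal at `p`. -/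
theorem mem_orthogonal_tangentSpace {p v : E} {C : ℝ}
    (h : ∀ q ∈ M, 2 * inner ℝ (q - p) v ≤ C * ‖q - p‖ ^ 2) : v ∈ (tangentSpace M p)ᗮ := by
  suffices tangentSpace M p ≤ (Submodule.span ℝ {v})ᗮ by
    refine (Submodule.mem_orthogonal _ _).2 fun w hw => ?_
    exact (Submodule.mem_orthogonal' _ _).1 (this hw) v (Submodule.mem_span_singleton_self v)
  refine Submodule.span_le.2 ?_
  rintro w ⟨γ, hγ, hγM, hγ0, rfl⟩
  have hγd : HasDerivAt γ (deriv γ 0) 0 := (hγ.differentiableAt (by simp)).hasDerivAt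
  have hsub : HasDerivAt (fun r => γ r - p) (deriv γ 0) 0 := hγd.sub_const p
  have hd := ((hsub.norm_sq).const_mul C).sub
    ((hsub.inner ℝ (hasDerivAt_const (0 : ℝ) v)).const_mul 2)
  -- The difference is nonnegative on both sides of `0` and vanishes at `0`; its derivative there is
  -- `-2⟪γ' 0, v⟫`.
  have hmin : IsLocalMin ((fun r => C * ‖γ r - p‖ ^ 2) - fun r => 2 * inner ℝ (γ r - p) v) 0 := by
    filter_upwards [hγM] with r hr
    simpa [hγ0] using h _ hr
  have h0 := hmin.hasDerivAt_eq_zero hd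
  simp only [hγ0, sub_self, inner_zero_left, inner_zero_right, mul_zero, zero_add, zero_sub] at h0
  refine Submodule.mem_orthogonal_singleton_iff_inner_left.2 ?_
  linarith

theorem IsNearestPoint.sub_mem_orthogonal {x p : E} (h : IsNearestPoint M x p) :
    x - p ∈ (tangentSpace M p)ᗮ :=
  mem_orthogonal_tangentSpace (C := 1) (by simpa using (isNearestPoint_iff.1 h).2)

theorem hasDerivAt_fderiv_line {F : Type*} [NormedAddCommGroup F] [NormedSpace ℝ F] {f : E → F}
    {z w : E} {r : ℝ} (hf : ContDiffAt ℝ 2 f (z + r • w)) :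
    HasDerivAt (fun r : ℝ => fderiv ℝ f (z + r • w) w)
      (fderiv ℝ (fderiv ℝ f) (z + r • w) w w) r := by
  have h1 : HasFDerivAt (fderiv ℝ f) (fderiv ℝ (fderiv ℝ f) (z + r • w)) (z + r • w) :=
    ((hf.fderiv_right (m := 1) (by norm_num)).differentiableAt (by simp)).hasFDerivAt
  have h2 := h1.comp_hasDerivAt r (hasDerivAt_line z w r)
  simpa using h2.clm_apply (hasDerivAt_const r w)

theorem hasDerivAt_comp_line {F : Type*} [NormedAddCommGroup F] [NormedSpace ℝ F] {f : E → F}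
    {z w : E} {r : ℝ} (hf : DifferentiableAt ℝ f (z + r • w)) :
    HasDerivAt (fun r : ℝ => f (z + r • w)) (fderiv ℝ f (z + r • w) w) r :=
  hf.hasFDerivAt.comp_hasDerivAt r (hasDerivAt_line z w r)

theorem deriv_deriv_line {F : Type*} [NormedAddCommGroup F] [NormedSpace ℝ F] {f : E → F}
    {z w : E} (hf : ContDiffAt ℝ 2 f z) :
    deriv (deriv fun r : ℝ => f (z + r • w)) 0 = fderiv ℝ (fderiv ℝ f) z w w := by
  have hline : ContinuousAt (fun r : ℝ => z + r • w) 0 := by fun_prop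
  have h0 : ContDiffAt ℝ 2 f (z + (0 : ℝ) • w) := by simpa using hf
  have h1 : deriv (fun r : ℝ => f (z + r • w)) =ᶠ[𝓝 0]
      fun r : ℝ => fderiv ℝ f (z + r • w) w := by
    have := hline.eventually (h0.eventually (by simp))
    filter_upwards [this] with r hr
    exact (hasDerivAt_comp_line (hr.differentiableAt (by simp))).deriv
  rw [h1.deriv_eq, (hasDerivAt_fderiv_line h0).deriv]
  simp

theorem eventually_norm_sub_lt {X H : Type*} [TopologicalSpace X] [SeminormedAddCommGroup H]
    {g : X → H} {x : X} (hg : ContinuousAt g x) {ε : ℝ} (hε : 0 < ε) :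
    ∀ᶠ y in 𝓝 x, ‖g y - g x‖ < ε := by
  filter_upwards [hg.eventually (Metric.ball_mem_nhds _ hε)] with y hy
  rwa [← dist_eq_norm]

/-- Stability of quadratic growth under linear perturbations along a subspace on which the
second derivative is positive definite. -/
theorem exists_growth_of_fderiv_fderiv_pos {F : Type*} [NormedAddCommGroup F]
    [InnerProductSpace ℝ F] {f : E → ℝ} {ψ : E → F} {y₀ : E} {c : ℝ}
    (hf : ContDiffAt ℝ 2 f y₀) (hψ : ContDiffAt ℝ 2 ψ y₀) (hc : 0 < c)
    (hpos : ∀ u ∈ V, c * ‖u‖ ^ 2 ≤ fderiv ℝ (fderiv ℝ f) y₀ u u) :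
    ∃ c' > 0, ∃ δ > 0, ∀ a : F, ‖a‖ < δ → ∀ z ∈ Metric.ball y₀ δ, ∀ y ∈ Metric.ball y₀ δ,
      y - z ∈ V →
      IsLocalMin (fun r : ℝ => f (z + r • (y - z)) - 2 * inner ℝ a (ψ (z + r • (y - z)))) 0 →
      f z - 2 * inner ℝ a (ψ z) + c' * ‖y - z‖ ^ 2 ≤ f y - 2 * inner ℝ a (ψ y) := by
  have hf2 : ContinuousAt (fderiv ℝ (fderiv ℝ f)) y₀ :=
    ((hf.fderiv_right (m := 1) (by norm_num)).fderiv_right (m := 0) (by simp)).continuousAt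
  have hψ2 : ContinuousAt (fderiv ℝ (fderiv ℝ ψ)) y₀ :=
    ((hψ.fderiv_right (m := 1) (by norm_num)).fderiv_right (m := 0) (by simp)).continuousAt
  set K := ‖fderiv ℝ (fderiv ℝ ψ) y₀‖ + 1 with hK
  have hK0 : 0 < K := by positivity
  have e1 : ∀ᶠ y in 𝓝 y₀, ‖fderiv ℝ (fderiv ℝ ψ) y‖ < K := by
    have := (continuous_norm (E := E →L[ℝ] E →L[ℝ] F)).continuousAt.comp hψ2
    exact this.eventually_lt_const (by simp [hK])
  have e2 : ∀ᶠ y in 𝓝 y₀, ‖fderiv ℝ (fderiv ℝ f) y - fderiv ℝ (fderiv ℝ f) y₀‖ < c / 2 := by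
    exact eventually_norm_sub_lt (H := E →L[ℝ] E →L[ℝ] ℝ) hf2 (half_pos hc)
  obtain ⟨δ, hδ, hball⟩ := Metric.eventually_nhds_iff_ball.1
    ((e1.and e2).and ((hf.eventually (by simp)).and (hψ.eventually (by simp))))
  -- Budget along the segment: of `c`, moving the base point costs at most `c / 2` and the
  -- perturbation at most `2 * (c / 8)`, leaving `c / 4 = 2 * (c / 8)`.
  refine ⟨c / 8, by positivity, min δ (c / (8 * K)), lt_min hδ (by positivity),
    fun a ha z hz y hy hV hmin => ?_⟩
  have hz' := Metric.ball_subset_ball (min_le_left _ _) hz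
  have hy' := Metric.ball_subset_ball (min_le_left _ _) hy
  have hline : ∀ r ∈ Set.Icc (0 : ℝ) 1, z + r • (y - z) ∈ Metric.ball y₀ δ := fun r hr =>
    (convex_ball y₀ δ).add_smul_sub_mem hz' hy' hr
  set w := y - z with hw
  have hd : ∀ r ∈ Set.Icc (0 : ℝ) 1,
      HasDerivAt (fun r : ℝ => f (z + r • w) - 2 * inner ℝ a (ψ (z + r • w)))
        (fderiv ℝ f (z + r • w) w - 2 * inner ℝ a (fderiv ℝ ψ (z + r • w) w)) r := by
    intro r hr
    obtain ⟨-, b3, b4⟩ := hball _ (hline r hr)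
    have h1 := hasDerivAt_comp_line (w := w) (b3.differentiableAt (by simp))
    have h2 := hasDerivAt_comp_line (w := w) (b4.differentiableAt (by simp))
    refine (h1.sub (((hasDerivAt_const r a).inner ℝ h2).const_mul 2)).congr_deriv ?_
    simp
  have hd2 : ∀ r ∈ Set.Icc (0 : ℝ) 1,
      HasDerivAt (fun r : ℝ => fderiv ℝ f (z + r • w) w -
          2 * inner ℝ a (fderiv ℝ ψ (z + r • w) w))
        (fderiv ℝ (fderiv ℝ f) (z + r • w) w w -
          2 * inner ℝ a (fderiv ℝ (fderiv ℝ ψ) (z + r • w) w w)) r := by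
    intro r hr
    obtain ⟨-, b3, b4⟩ := hball _ (hline r hr)
    have h1 := hasDerivAt_fderiv_line (w := w) b3
    have h2 := hasDerivAt_fderiv_line (w := w) b4
    refine (h1.sub (((hasDerivAt_const r a).inner ℝ h2).const_mul 2)).congr_deriv ?_
    simp
  have hge : ∀ r ∈ Set.Icc (0 : ℝ) 1, 2 * (c / 8 * ‖w‖ ^ 2) ≤
      fderiv ℝ (fderiv ℝ f) (z + r • w) w w -
          2 * inner ℝ a (fderiv ℝ (fderiv ℝ ψ) (z + r • w) w w) := by
    intro r hr
    obtain ⟨⟨b1, b2⟩, -⟩ := hball _ (hline r hr)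
    have h1 : fderiv ℝ (fderiv ℝ f) (z + r • w) w w ≥
        fderiv ℝ (fderiv ℝ f) y₀ w w - c / 2 * ‖w‖ * ‖w‖ := by
      have := (fderiv ℝ (fderiv ℝ f) (z + r • w) - fderiv ℝ (fderiv ℝ f) y₀).le_opNorm₂ w w
      have h3 : ‖fderiv ℝ (fderiv ℝ f) (z + r • w) - fderiv ℝ (fderiv ℝ f) y₀‖ * ‖w‖ * ‖w‖ ≤
          c / 2 * ‖w‖ * ‖w‖ := by gcongr
      have h4 := (abs_le.1 (this.trans h3)).1
      simp only [sub_apply] at h4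
      linarith
    have h2 : inner ℝ a (fderiv ℝ (fderiv ℝ ψ) (z + r • w) w w) ≤ c / 8 * ‖w‖ ^ 2 := by
      calc _ ≤ ‖a‖ * ‖fderiv ℝ (fderiv ℝ ψ) (z + r • w) w w‖ := real_inner_le_norm _ _
        _ ≤ c / (8 * K) * (K * ‖w‖ * ‖w‖) := by
          gcongr
          · exact (ha.trans_le (min_le_right _ _)).le
          · exact (ContinuousLinearMap.le_opNorm₂ _ _ _).trans (by gcongr)
        _ = _ := by field_simp
    nlinarith [hpos w hV]
  have hcrit := hmin.hasDerivAt_eq_zero (hd 0 (by simp))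
  have := add_mul_sq_le_of_deriv2_ge hd hd2 hge hcrit
  simpa [hw] using this

/-- A semidefinite form with `b u u = 0` and `b u v ≠ 0` takes a negative value at `s • u + v` for
suitable `s`; thus nondegeneracy gives definiteness, and compactness of the unit sphere gives `c`.
-/
theorem exists_mul_sq_le_of_nondegenerate [FiniteDimensional ℝ E] (b : E →L[ℝ] E →L[ℝ] ℝ)
    (hsymm : ∀ u v, b u v = b v u) (hnonneg : ∀ u ∈ V, 0 ≤ b u u)
    (hnd : ∀ u ∈ V, u ≠ 0 → ∃ v ∈ V, b u v ≠ 0) :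
    ∃ c > 0, ∀ u ∈ V, c * ‖u‖ ^ 2 ≤ b u u := by
  have hpos : ∀ u ∈ V, u ≠ 0 → 0 < b u u := by
    intro u hu hu0
    refine lt_of_le_of_ne (hnonneg u hu) fun h0 => ?_
    obtain ⟨v, hv, hne⟩ := hnd u hu hu0
    set s := -(b v v + 1) / (2 * b u v) with hs
    have h1 := hnonneg (s • u + v) (V.add_mem (V.smul_mem s hu) hv)
    have h2 : b (s • u + v) (s • u + v) = s * (2 * b u v) + b v v := by
      simp only [map_add, map_smul, add_apply, smul_apply, smul_eq_mul, hsymm v u, ← h0]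
      ring
    have h3 : s * (2 * b u v) = -(b v v + 1) := by
      rw [hs]; field_simp
    linarith
  have hcpt : IsCompact (Metric.sphere (0 : E) 1 ∩ V) :=
    (isCompact_sphere 0 1).inter_right V.closed_of_finiteDimensional
  obtain ⟨c, hc, h⟩ := hcpt.exists_forall_le' (f := fun u => b u u) (by fun_prop) (a := 0)
    (fun u hu => hpos u hu.2 (by rintro rfl; simpa using hu.1))
  refine ⟨c, hc, fun u hu => ?_⟩
  rcases eq_or_ne u 0 with rfl | hu0
  · simp
  have hn : ‖u‖ ≠ 0 := norm_ne_zero_iff.2 hu0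
  have := h (‖u‖⁻¹ • u) ⟨by simp [norm_smul, hn], V.smul_mem _ hu⟩
  simp only [map_smul, smul_apply, smul_eq_mul] at this
  have h4 : b u u = ‖u‖ ^ 2 * (‖u‖⁻¹ * (‖u‖⁻¹ * b u u)) := by field_simp
  rw [h4, mul_comm]
  gcongr

end QuadGrowth

end CutLocus
end

noncomputable section

namespace CutLocus

variable {E : Type*} [NormedAddCommGroup E] [InnerProductSpace ℝ E]

/-! ### Quadratic growth characterizes the complement of the cutlocus; normal rays. -/

section Cutlocus

variable {M : Set E} {V : Submodule ℝ E} {Φ : OpenPartialHomeomorph E E}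

theorem IsSliceChart.contDiffAt_norm_sq (h : IsSliceChart M V Φ) {y : E} (hy : y ∈ Φ.target)
    (x : E) : ContDiffAt ℝ 2 ((fun q => ‖q - x‖ ^ 2) ∘ Φ.symm) y := by
  have h1 : ContDiffAt ℝ 2 (fun y => Φ.symm y - x) y :=
    ((h.contDiffAt_symm hy).of_le two_le_top).sub contDiffAt_const
  exact h1.norm_sq ℝ

/-- The second derivative along a slice is nonnegative at a nearest point. -/
theorem IsSliceChart.fderiv_fderiv_nonneg (h : IsSliceChart M V Φ) {x p : E}
    (hp : IsNearestPoint M x p) (ps : p ∈ Φ.source) {u : E} (hu : u ∈ V) :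
    0 ≤ fderiv ℝ (fderiv ℝ ((fun q => ‖q - x‖ ^ 2) ∘ Φ.symm)) (Φ p) u u := by
  have hC := h.contDiffAt_norm_sq (Φ.map_source ps) x
  rw [← deriv_deriv_line hC]
  refine deriv_deriv_nonneg_of_isLocalMin ?_ ?_
  · filter_upwards [h.eventually_line_mem ps hp.1 hu] with r hr
    simpa [Φ.left_inv ps] using hp.2 _ hr
  · refine ContinuousAt.comp (g := (fun q => ‖q - x‖ ^ 2) ∘ Φ.symm) ?_ (by fun_prop)
    simpa using hC.continuousAt

/-- Quadratic growth excludes a degenerate second derivative. -/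
theorem QuadGrowth.notMem_cutlocus {c : ℝ} {x p : E} (h : QuadGrowth M c x p) (hc : 0 < c) :
    x ∉ cutlocus M := by
  have hp := h.isNearestPoint hc.le
  have huniq : ∃! p, IsNearestPoint M x p := ⟨p, hp, fun q hq => h.eq hc hq⟩
  have hpe : nearestPoint M x = p := h.eq hc (isNearestPoint_nearestPoint huniq.exists)
  rintro (h1 | h1)
  · exact h1 huniq
  rw [hpe] at h1
  obtain ⟨V, Φ, hΦ, ps, u, hu, hu0, hdeg⟩ := h1
  obtain ⟨L, hL, δ, hδ, hLip⟩ := exists_norm_sub_le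
    ((hΦ.contDiffAt ps).of_le (by exact_mod_cast le_top))
  -- The chart is `L`-Lipschitz near `p`, so the coordinate line leaves `p` at speed at least `‖u‖ /
  -- (L + 1)`; adding one avoids division by zero.
  set k := c * (‖u‖ / (L + 1)) ^ 2 with hk
  have hk0 : 0 < k := by
    have := norm_pos_iff.2 hu0
    positivity
  set f := (fun q => ‖q - x‖ ^ 2) ∘ Φ.symm with hf
  have hC : ContDiffAt ℝ 2 f (Φ p) := hΦ.contDiffAt_norm_sq (Φ.map_source ps) x
  -- subtracting a multiple of the square leaves a local minimum with negative second derivative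
  have hC2 : ContDiffAt ℝ 2 (fun r : ℝ => f (Φ p + r • u)) 0 := by
    refine ContDiffAt.comp (g := f) (0 : ℝ) ?_ (by fun_prop)
    simpa using hC
  have hmin : IsLocalMin (fun r : ℝ => f (Φ p + r • u) - k * r ^ 2) 0 := by
    have hcont : ContinuousAt (fun r : ℝ => Φ.symm (Φ p + r • u)) 0 :=
      (hΦ.contDiffAt_line ps u).continuousAt
    have hball : ∀ᶠ r : ℝ in 𝓝 0, Φ.symm (Φ p + r • u) ∈ Metric.ball p δ :=
      hcont.preimage_mem_nhds (by
        simpa only [zero_smul, add_zero, Φ.left_inv ps] using Metric.ball_mem_nhds p hδ)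
    filter_upwards [hΦ.eventually_line_mem ps hp.1 hu,
      IsSliceChart.eventually_line_mem_target ps u, hball] with r hr hrt hrb
    have h1 := h.2 _ hr
    have h2 := hLip p (Metric.mem_ball_self hδ) _ hrb
    rw [Φ.right_inv hrt, add_sub_cancel_left, norm_smul, Real.norm_eq_abs] at h2
    have h3 : |r| * ‖u‖ ≤ (L + 1) * ‖Φ.symm (Φ p + r • u) - p‖ :=
      h2.trans (by gcongr; linarith)
    have h4 : k * r ^ 2 ≤ c * ‖Φ.symm (Φ p + r • u) - p‖ ^ 2 := by
      have : k * r ^ 2 = c * ((|r| * ‖u‖) / (L + 1)) ^ 2 := by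
        rw [hk, ← sq_abs r]; ring
      rw [this]
      gcongr
      rw [div_le_iff₀ (by positivity)]
      linarith
    simp only [hf, Function.comp, zero_smul, add_zero, Φ.left_inv ps]
    simp only [ne_eq, OfNat.ofNat_ne_zero, not_false_eq_true, zero_pow, mul_zero, sub_zero]
    linarith
  have hd2 : deriv (deriv fun r : ℝ => f (Φ p + r • u) - k * r ^ 2) 0 = -(2 * k) := by
    have e1 : deriv (fun r : ℝ => f (Φ p + r • u) - k * r ^ 2) =ᶠ[𝓝 0]
        fun r => deriv (fun r : ℝ => f (Φ p + r • u)) r - 2 * k * r := by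
      filter_upwards [hC2.eventually (by simp)] with r hr
      have hq : HasDerivAt (fun r : ℝ => k * r ^ 2) (2 * k * r) r := by
        refine ((hasDerivAt_pow 2 r).const_mul k).congr_deriv ?_
        simp; ring
      exact ((hr.differentiableAt (by simp)).hasDerivAt.sub hq).deriv
    have hdd : DifferentiableAt ℝ (deriv fun r : ℝ => f (Φ p + r • u)) 0 := by
      have h5 := (hC2.fderiv_right (m := 1) (by norm_num)).differentiableAt (by simp)
      exact h5.clm_apply (differentiableAt_const 1)
    have hq : HasDerivAt (fun r : ℝ => 2 * k * r) (2 * k) 0 := by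
      simpa using (hasDerivAt_id (0 : ℝ)).const_mul (2 * k)
    rw [e1.deriv_eq]
    refine (hdd.hasDerivAt.sub hq).deriv.trans ?_
    rw [deriv_deriv_line hC, hdeg u hu, zero_sub]
  have := deriv_deriv_nonneg_of_isLocalMin hmin
    (hC2.continuousAt.sub (by fun_prop))
  linarith

variable [FiniteDimensional ℝ E]

/-- Locally uniform quadratic growth near the nearest point of a point off the cutlocus. -/
theorem IsSliceChart.exists_local_growth (h : IsSliceChart M V Φ) {x : E}
    (hx : x ∉ cutlocus M) (ps : nearestPoint M x ∈ Φ.source) :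
    ∃ c > 0, ∃ δ > 0, ∀ x' ∈ Metric.ball x δ, ∀ p ∈ Metric.ball (nearestPoint M x) δ,
      IsNearestPoint M x' p → ∀ q ∈ Metric.ball (nearestPoint M x) δ, q ∈ M →
        ‖p - x'‖ ^ 2 + c * ‖q - p‖ ^ 2 ≤ ‖q - x'‖ ^ 2 := by
  set p₀ := nearestPoint M x with hp₀
  have hnear : IsNearestPoint M x p₀ := isNearestPoint_of_notMem_cutlocus hx
  set f := (fun q => ‖q - x‖ ^ 2) ∘ Φ.symm with hf
  have hy₀ := Φ.map_source ps
  have hC : ContDiffAt ℝ 2 f (Φ p₀) := h.contDiffAt_norm_sq hy₀ x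
  have hsymm : ∀ u v, fderiv ℝ (fderiv ℝ f) (Φ p₀) u v = fderiv ℝ (fderiv ℝ f) (Φ p₀) v u :=
    fun u v => (hC.isSymmSndFDerivAt (by simp)).eq u v
  -- Minimality makes the second derivative semidefinite; `x` being off the cutlocus makes it
  -- nondegenerate.
  obtain ⟨c, hc, hpos⟩ := exists_mul_sq_le_of_nondegenerate (V := V) _ hsymm
    (fun u hu => h.fderiv_fderiv_nonneg hnear ps hu) (by
      intro u hu hu0
      by_contra! hcon
      exact hx (Or.inr ⟨V, Φ, h, ps, u, hu, hu0, hcon⟩))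
  have hψ : ContDiffAt ℝ 2 Φ.symm (Φ p₀) := (h.contDiffAt_symm hy₀).of_le two_le_top
  obtain ⟨c', hc', δ, hδ, hg⟩ := exists_growth_of_fderiv_fderiv_pos hC hψ hc hpos
  obtain ⟨L, hL, δ₂, hδ₂, hLip⟩ := exists_norm_sub_le (hψ.of_le (by norm_num))
  have e1 : ∀ᶠ q in 𝓝 p₀, Φ q ∈ Metric.ball (Φ p₀) (min δ δ₂) :=
    (Φ.continuousAt ps).eventually (Metric.ball_mem_nhds _ (lt_min hδ hδ₂))
  obtain ⟨δ₃, hδ₃, hb⟩ := Metric.eventually_nhds_iff_ball.1 (e1.and (Φ.open_source.mem_nhds ps))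
  refine ⟨c' / (L + 1) ^ 2, by positivity, min δ δ₃, lt_min hδ hδ₃, fun x' hx' p hp hpn q hq hqM => ?_⟩
  obtain ⟨hpb, hps⟩ := hb p (Metric.ball_subset_ball (min_le_right _ _) hp)
  obtain ⟨hqb, hqs⟩ := hb q (Metric.ball_subset_ball (min_le_right _ _) hq)
  have hw : Φ q - Φ p ∈ V := V.sub_mem ((h.mem_iff q hqs).1 hqM) ((h.mem_iff p hps).1 hpn.1)
  -- Up to a constant, moving the centre from `x` to `x'` is a linear perturbation by `a = x' - x`.
  have hexp : ∀ y : E, ‖y - x'‖ ^ 2 =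
      ‖y - x‖ ^ 2 - 2 * inner ℝ (x' - x) y + (2 * inner ℝ (x' - x) x + ‖x' - x‖ ^ 2) := by
    intro y
    have : y - x' = (y - x) - (x' - x) := by abel
    rw [this, norm_sub_sq_real, real_inner_comm, inner_sub_right]
    ring
  have key := hg (x' - x) (by
      rw [← dist_eq_norm]; exact (Metric.mem_ball.1 hx').trans_le (min_le_left _ _))
    (Φ p) (Metric.ball_subset_ball (min_le_left _ _) hpb)
    (Φ q) (Metric.ball_subset_ball (min_le_left _ _) hqb) hw (by
      filter_upwards [h.eventually_line_mem hps hpn.1 hw] with r hr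
      have h1 := hpn.2 _ hr
      rw [hexp, hexp (Φ.symm _)] at h1
      simp only [hf, Function.comp, zero_smul, add_zero, Φ.left_inv hps]
      linarith)
  simp only [hf, Function.comp, Φ.left_inv hps, Φ.left_inv hqs] at key
  have hl := hLip _ (Metric.ball_subset_ball (min_le_right _ _) hpb) _
    (Metric.ball_subset_ball (min_le_right _ _) hqb)
  rw [Φ.left_inv hps, Φ.left_inv hqs] at hl
  have hl2 : c' / (L + 1) ^ 2 * ‖q - p‖ ^ 2 ≤ c' * ‖Φ q - Φ p‖ ^ 2 := by
    have : c' / (L + 1) ^ 2 * ‖q - p‖ ^ 2 = c' * (‖q - p‖ / (L + 1)) ^ 2 := by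
      rw [div_pow]; ring
    rw [this]
    gcongr
    rw [div_le_iff₀ (by positivity)]
    nlinarith [norm_nonneg (Φ q - Φ p)]
  rw [hexp p, hexp q]
  linarith

/-- Locally uniform quadratic growth off the cutlocus. -/
theorem IsSubmanifold.exists_quadGrowth {m : ℕ} (hM : IsSubmanifold m M) (hc : IsCompact M)
    {x : E} (hx : x ∉ cutlocus M) :
    ∃ c > 0, ∃ δ > 0, ∀ x' ∈ Metric.ball x δ, ∀ p, IsNearestPoint M x' p →
      QuadGrowth M c x' p := by
  set p₀ := nearestPoint M x with hp₀
  have hnear : IsNearestPoint M x p₀ := isNearestPoint_of_notMem_cutlocus hx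
  obtain ⟨V, Φ, h, ps, -⟩ := hM p₀ hnear.1
  obtain ⟨c, hc0, δ, hδ, hloc⟩ := h.exists_local_growth hx ps
  -- Outside the ball, uniqueness of the nearest point and compactness leave a positive gap `e`,
  -- half of which survives for `x'` near `x`.
  obtain ⟨η, hη, hfar⟩ := (hc.diff Metric.isOpen_ball).exists_forall_le'
    (s := M \ Metric.ball p₀ δ) (f := fun q => ‖q - x‖ ^ 2) (by fun_prop) (a := ‖p₀ - x‖ ^ 2)
    (fun q hq => lt_of_not_ge fun hle => hq.2 (by
      rw [hp₀, ← eq_nearestPoint hx ⟨hq.1, fun y hy => hle.trans (hnear.2 y hy)⟩]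
      exact Metric.mem_ball_self hδ))
  obtain ⟨R, hR⟩ := Metric.isBounded_iff.1 hc.isBounded
  set R' := max R 1 with hR'
  have hRpos : 0 < R' := lt_max_of_lt_right one_pos
  have hRd : ∀ a ∈ M, ∀ b ∈ M, ‖a - b‖ ≤ R' := fun a ha b hb => by
    rw [← dist_eq_norm]; exact (hR ha hb).trans (le_max_left _ _)
  set e := η - ‖p₀ - x‖ ^ 2 with he
  have he0 : 0 < e := sub_pos.2 hη
  have hfar' : ∀ x' ∈ Metric.ball x (e / (4 * R')), ∀ q ∈ M, q ∉ Metric.ball p₀ δ →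
      ‖p₀ - x'‖ ^ 2 + e / 2 ≤ ‖q - x'‖ ^ 2 := by
    intro x' hx' q hq hqb
    have h1 := hfar q ⟨hq, hqb⟩
    have h2 : inner ℝ (q - p₀) (x' - x) ≤ e / 4 := by
      calc _ ≤ ‖q - p₀‖ * ‖x' - x‖ := real_inner_le_norm _ _
        _ ≤ R' * (e / (4 * R')) := by
          gcongr
          · exact hRd q hq p₀ hnear.1
          · rw [← dist_eq_norm]; exact (Metric.mem_ball.1 hx').le
        _ = e / 4 := by field_simp
    have h3 := norm_sub_sq_eq q p₀ x
    have h4 := norm_sub_sq_eq q p₀ x'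
    have h5 : inner ℝ (q - p₀) (x' - p₀) = inner ℝ (q - p₀) (x' - x) + inner ℝ (q - p₀) (x - p₀) := by
      rw [← inner_add_right]; congr 1; abel
    linarith
  refine ⟨min c (e / (2 * R' ^ 2)), lt_min hc0 (by positivity), min δ (e / (4 * R')),
    lt_min hδ (by positivity), fun x' hx' p hp => ⟨hp.1, fun q hq => ?_⟩⟩
  have hx1 := Metric.ball_subset_ball (min_le_left _ _) hx'
  have hx2 := Metric.ball_subset_ball (min_le_right _ _) hx'
  have hple := hp.2 p₀ hnear.1
  -- A nearest point outside the ball would be beaten by `p₀`.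
  have hpb : p ∈ Metric.ball p₀ δ := by
    by_contra hcon
    linarith [hfar' x' hx2 p hp.1 hcon]
  by_cases hqb : q ∈ Metric.ball p₀ δ
  · refine le_trans ?_ (hloc x' hx1 p hpb hp q hqb hq)
    gcongr
    exact min_le_left _ _
  · refine le_trans ?_ (hfar' x' hx2 q hq hqb)
    refine add_le_add hple ?_
    calc _ ≤ e / (2 * R' ^ 2) * R' ^ 2 := by
          gcongr
          · exact min_le_right _ _
          · exact hRd q hq p hp.1
      _ = e / 2 := by field_simp

/-- Quadratic growth persists on a neighbourhood of a point off the cutlocus, and it excludes the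
cutlocus there. -/
theorem IsSubmanifold.isClosed_cutlocus {m : ℕ} (hM : IsSubmanifold m M) (hc : IsCompact M) :
    IsClosed (cutlocus M) := by
  refine isOpen_compl_iff.1 (Metric.isOpen_iff.2 fun x hx => ?_)
  obtain ⟨c, hc0, δ, hδ, h⟩ := hM.exists_quadGrowth hc hx
  refine ⟨δ, hδ, fun x' hx' => ?_⟩
  obtain ⟨p, hp⟩ := exists_isNearestPoint hc ⟨_, (isNearestPoint_of_notMem_cutlocus hx).1⟩ x'
  exact (h x' hx' p hp).notMem_cutlocus hc0

/-- Along a normal ray the foot point stays nearest until the cutlocus is reached. -/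
theorem IsSubmanifold.isNearestPoint_ray {m : ℕ} (hM : IsSubmanifold m M) (hc : IsCompact M)
    {p v : E} {a b : ℝ} (ha : 0 < a) (hab : a ≤ b) (hp : IsNearestPoint M (p + a • v) p)
    (hC : ∀ r ∈ Set.Icc a b, p + r • v ∉ cutlocus M) : IsNearestPoint M (p + b • v) p := by
  have hiff : ∀ r : ℝ, IsNearestPoint M (p + r • v) p ↔
      ∀ q ∈ M, r * (2 * inner ℝ (q - p) v) ≤ ‖q - p‖ ^ 2 := by
    intro r
    rw [isNearestPoint_iff, and_iff_right hp.1]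
    refine forall₂_congr fun q _ => ?_
    rw [add_sub_cancel_left, inner_smul_right]
    ring_nf
  set S : Set ℝ := {r | IsNearestPoint M (p + r • v) p} with hS
  have hSc : IsClosed S := by
    have : S = ⋂ q ∈ M, {r : ℝ | r * (2 * inner ℝ (q - p) v) ≤ ‖q - p‖ ^ 2} := by
      ext r; simp [hS, hiff]
    rw [this]
    exact isClosed_biInter fun q _ => isClosed_le (by fun_prop) (by fun_prop)
  have hsub : Set.Icc a b ⊆ S := by
    -- Continuity method: the good parameters form a closed set, and growth with constant `c` at `r`
    -- allows the parameter to increase up to `r * (1 + c)`, since `(1 + c) * (1 - c) ≤ 1`.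
    refine (hSc.inter isClosed_Icc).Icc_subset_of_forall_exists_gt hp ?_
    rintro r ⟨hr, har, hrb⟩ y hy
    have hrpos : 0 < r := ha.trans_le har
    obtain ⟨c, hc0, δ, hδ, h⟩ := hM.exists_quadGrowth hc (hC r ⟨har, hrb.le⟩)
    have hq := h _ (Metric.mem_ball_self hδ) p hr
    refine ⟨min y (r * (1 + c)), (hiff _).2 fun q hqM => ?_, lt_min hy (by nlinarith), min_le_left _ _⟩
    have h1 := hq.2 q hqM
    rw [norm_sub_sq_eq q p (p + r • v), add_sub_cancel_left, inner_smul_right] at h1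
    rcases le_or_gt 0 (inner ℝ (q - p) v) with h0 | h0
    · calc _ ≤ r * (1 + c) * (2 * inner ℝ (q - p) v) := by gcongr; exact min_le_right _ _
        _ = (1 + c) * (2 * (r * inner ℝ (q - p) v)) := by ring
        _ ≤ (1 + c) * ((1 - c) * ‖q - p‖ ^ 2) :=
          mul_le_mul_of_nonneg_left (by linarith) (by positivity)
        _ ≤ _ := by nlinarith [mul_nonneg (sq_nonneg c) (sq_nonneg ‖q - p‖)]
    · have : 0 < min y (r * (1 + c)) := lt_min (hrpos.trans hy) (by positivity)
      nlinarith [mul_neg_of_pos_of_neg this h0, sq_nonneg ‖q - p‖]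
  exact hsub ⟨hab, le_rfl⟩

end Cutlocus

end CutLocus
end

noncomputable section

namespace CutLocus

variable {E : Type*} [NormedAddCommGroup E] [InnerProductSpace ℝ E] [FiniteDimensional ℝ E]

/-! ### The expansion of the nearest-point mapping with explicit remainder. -/

section Estimate

variable {M : Set E}

/-- A compact submanifold with empty cutlocus has at most one point. -/
theorem IsSubmanifold.subsingleton_of_cutlocus_eq_empty {m : ℕ} (hM : IsSubmanifold m M)
    (hc : IsCompact M) (hC : cutlocus M = ∅) : M.Subsingleton := by
  rcases M.eq_empty_or_nonempty with rfl | hne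
  · exact Set.subsingleton_empty
  -- At a point `p` of maximal norm, `p` itself is normal. Without a cutlocus the inward ray from
  -- `p` never ends, so `p` is nearest to a point at or beyond `-p`; maximality of `‖p‖` then leaves
  -- no other point of `M`.
  obtain ⟨p, hp, hmax⟩ := hc.exists_isMaxOn hne (f := fun q => ‖q‖) (by fun_prop)
  have hpq : ∀ q ∈ M, 2 * inner ℝ (q - p) p ≤ -1 * ‖q - p‖ ^ 2 := by
    intro q hq
    have h1 : ‖q‖ ≤ ‖p‖ := hmax hq
    have h2 : ‖q‖ ^ 2 ≤ ‖p‖ ^ 2 := by gcongr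
    have h3 : ‖q‖ ^ 2 = ‖(q - p) + p‖ ^ 2 := by simp
    rw [norm_add_sq_real] at h3
    linarith
  have hnormal : p ∈ (tangentSpace M p)ᗮ := mem_orthogonal_tangentSpace hpq
  obtain ⟨K, hK, hb⟩ := hM.exists_pairBound hc
  set a := 1 / (2 * (K * ‖p‖ + 1)) with ha
  have hden : 0 < 2 * (K * ‖p‖ + 1) := by positivity
  have ha0 : 0 < a := by positivity
  have hstart : IsNearestPoint M (p + a • (-p)) p := by
    refine isNearestPoint_iff.2 ⟨hp, fun q hq => ?_⟩
    rw [add_sub_cancel_left, inner_smul_right, inner_neg_right]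
    have h1 : inner ℝ (q - p) p = inner ℝ (q - p - tanProj M p (q - p)) p := by
      rw [inner_sub_left (q - p), real_inner_comm _ (tanProj M p (q - p)),
        inner_eq_zero_of_mem hnormal (tanProj_apply_mem M p _), sub_zero]
    have h2 : -inner ℝ (q - p) p ≤ K * ‖q - p‖ ^ 2 * ‖p‖ := by
      rw [h1]
      refine (neg_le_abs _).trans ((abs_real_inner_le_norm _ _).trans ?_)
      gcongr
      exact (hb p hp q hq).norm_nor_le
    calc 2 * (a * -inner ℝ (q - p) p) ≤ 2 * (a * (K * ‖q - p‖ ^ 2 * ‖p‖)) := by gcongr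
      _ = (2 * (K * ‖p‖)) / (2 * (K * ‖p‖ + 1)) * ‖q - p‖ ^ 2 := by rw [ha]; ring
      _ ≤ 1 * ‖q - p‖ ^ 2 := by
        gcongr
        rw [div_le_one hden]
        linarith
      _ = _ := one_mul _
  have hend : IsNearestPoint M (p + (max a 2) • (-p)) p :=
    hM.isNearestPoint_ray hc ha0 (le_max_left _ _) hstart (by simp [hC])
  have hall : ∀ q ∈ M, q = p := by
    intro q hq
    have h1 := (isNearestPoint_iff.1 hend).2 q hq
    rw [add_sub_cancel_left, inner_smul_right, inner_neg_right] at h1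
    have h2 := hpq q hq
    have h3 : (2 : ℝ) ≤ max a 2 := le_max_right _ _
    have h4 : ‖q - p‖ ^ 2 ≤ 0 := by nlinarith [sq_nonneg ‖q - p‖]
    have h5 : ‖q - p‖ = 0 := (pow_eq_zero_iff two_ne_zero).1 (le_antisymm h4 (sq_nonneg _))
    exact sub_eq_zero.1 (norm_eq_zero.1 h5)
  exact fun x hx y hy => (hall x hx).trans (hall y hy).symm

theorem tangentSpace_eq_bot_of_subsingleton (hM : M.Subsingleton) (p : E) :
    tangentSpace M p = ⊥ := by
  refine le_antisymm (Submodule.span_le.2 ?_) bot_le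
  rintro v ⟨γ, hγ, hγM, hγ0, rfl⟩
  have h : γ =ᶠ[𝓝 0] fun _ => γ 0 := by
    filter_upwards [hγM] with r hr using hM hr hγM.self_of_nhds
  simp [h.deriv_eq]

theorem norm_sub_nearestPoint_eq {x : E} (hx : x ∉ cutlocus M) :
    ‖x - nearestPoint M x‖ = Metric.infDist x M := by
  have h := isNearestPoint_of_notMem_cutlocus hx
  refine le_antisymm ?_ ?_
  · refine (Metric.le_infDist ⟨_, h.1⟩).2 fun q hq => ?_
    have := h.2 q hq
    rw [dist_eq_norm, norm_sub_rev x, norm_sub_rev x]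
    exact le_of_sq_le_sq this (norm_nonneg _)
  · rw [← dist_eq_norm]
    exact Metric.infDist_le_dist_of_mem h.1

/-- Extending the normal segment of `x` by a fraction of the distance to the cutlocus. -/
theorem IsSubmanifold.mul_inner_le {m : ℕ} (hM : IsSubmanifold m M) (hc : IsCompact M)
    {x q : E} (hx : x ∉ cutlocus M) {b : ℝ} (hb : 0 ≤ b)
    (hbC : b * ‖x - nearestPoint M x‖ < Metric.infDist x (cutlocus M)) (hq : q ∈ M) :
    2 * (1 + b) * inner ℝ (q - nearestPoint M x) (x - nearestPoint M x) ≤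
      ‖q - nearestPoint M x‖ ^ 2 := by
  have hn := isNearestPoint_of_notMem_cutlocus hx
  set p := nearestPoint M x
  have h1 := hM.isNearestPoint_ray hc (p := p) (v := x - p) one_pos (b := 1 + b) (by linarith)
    (by simpa using hn) (fun r hr hmem => by
      have h2 := Metric.infDist_le_dist_of_mem (x := x) hmem
      have h3 : dist x (p + r • (x - p)) = (r - 1) * ‖x - p‖ := by
        rw [dist_comm, dist_eq_norm]
        have : p + r • (x - p) - x = (r - 1) • (x - p) := by
          rw [sub_smul, one_smul]; abel
        rw [this, norm_smul, Real.norm_of_nonneg (by linarith [hr.1])]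
      have h4 : (r - 1) * ‖x - p‖ ≤ b * ‖x - p‖ := by gcongr; linarith [hr.2]
      linarith)
  have h2 := (isNearestPoint_iff.1 h1).2 q hq
  rw [add_sub_cancel_left, inner_smul_right] at h2
  linarith

/-- Lipschitz estimate of the nearest-point mapping. -/
theorem IsSubmanifold.norm_nearestPoint_sub_le {m : ℕ} (hM : IsSubmanifold m M)
    (hc : IsCompact M) {x y : E} (hx : x ∉ cutlocus M) (hy : y ∉ cutlocus M) {b : ℝ} (hb : 0 ≤ b)
    (hbx : b * ‖x - nearestPoint M x‖ < Metric.infDist x (cutlocus M))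
    (hby : b * ‖y - nearestPoint M y‖ < Metric.infDist y (cutlocus M)) :
    b * ‖nearestPoint M y - nearestPoint M x‖ ≤ (1 + b) * ‖y - x‖ := by
  have h1 := hM.mul_inner_le hc hx hb hbx (isNearestPoint_of_notMem_cutlocus hy).1
  have h2 := hM.mul_inner_le hc hy hb hby (isNearestPoint_of_notMem_cutlocus hx).1
  set p := nearestPoint M x
  set q := nearestPoint M y
  have h3 : inner ℝ (p - q) (y - q) =
      ‖q - p‖ ^ 2 - inner ℝ (q - p) (y - x) - inner ℝ (q - p) (x - p) := by
    have e1 : p - q = -(q - p) := by abel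
    have e2 : y - q = (y - x) + (x - p) - (q - p) := by abel
    rw [e2, e1, inner_neg_left, inner_sub_right, inner_add_right, real_inner_self_eq_norm_sq]
    ring
  rw [norm_sub_rev p q, h3] at h2
  have h4 : inner ℝ (q - p) (y - x) ≤ ‖q - p‖ * ‖y - x‖ := real_inner_le_norm _ _
  -- In the sum of `h1` and `h2` the terms in `x - p` cancel, leaving `b ‖q - p‖ ^ 2 ≤ (1 + b) ⟪q -
  -- p, y - x⟫`.
  have h5 : b * ‖q - p‖ ^ 2 ≤ (1 + b) * (‖q - p‖ * ‖y - x‖) := by nlinarith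
  rcases (norm_nonneg (q - p)).eq_or_lt with h0 | h0
  · rw [← h0]; simp; positivity
  · refine le_of_mul_le_mul_right ?_ h0
    linarith

/-- The first order expansion of the nearest-point mapping, with an explicit remainder in terms of
the distance to the cutlocus. If the cutlocus is empty, the right-hand side is `0`. -/
theorem IsSubmanifold.exists_norm_stabilizer_sub_le {m : ℕ} (hM : IsSubmanifold m M)
    (hc : IsCompact M) {D : ℝ} (hD : 0 < D) :
    ∃ K : ℝ, 0 ≤ K ∧ ∀ t ∉ cutlocus M, Metric.infDist t M ≤ D → ∀ t' : E,
      (cutlocus M = ∅ ∨ ‖t' - t‖ ≤ Metric.infDist t (cutlocus M) / 2) →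
      t' ∉ cutlocus M ∧
      ‖stabilizer M t (nearestPoint M t' - nearestPoint M t) -
        tanProj M (nearestPoint M t) (t' - t)‖ ≤
          K * (‖t' - t‖ ^ 2 / Metric.infDist t (cutlocus M) ^ 2) := by
  -- With empty cutlocus `M` has at most one point, so both terms on the left vanish, as they must:
  -- `Metric.infDist` to `∅` is `0` and so is the bound.
  rcases (cutlocus M).eq_empty_or_nonempty with hC | ⟨c₀, hc₀⟩
  · refine ⟨0, le_rfl, fun t ht _ t' _ => ⟨by simp [hC], ?_⟩⟩
    have hsub := hM.subsingleton_of_cutlocus_eq_empty hc hC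
    have ht' : t' ∉ cutlocus M := by simp [hC]
    have h1 : nearestPoint M t' = nearestPoint M t :=
      hsub (isNearestPoint_of_notMem_cutlocus ht').1 (isNearestPoint_of_notMem_cutlocus ht).1
    have h2 : tanProj M (nearestPoint M t) (t' - t) = 0 :=
      tanProj_eq_zero (by rw [tangentSpace_eq_bot_of_subsingleton hsub]; simp)
    simp [h1, h2]
  obtain ⟨K₀, hK₀, hb⟩ := hM.exists_pairBound hc
  obtain ⟨R₀, hR₀⟩ := hc.isBounded.exists_norm_le
  -- `R` bounds `d`; `D'` strictly exceeds the distances of `t` and `t'` to `M`. Below, the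
  -- admissible prolongation is `b = d / (4 * D') ≤ R`, and `(1 + b) / b ≤ L / d`.
  set R := D + |R₀| + ‖c₀‖ with hR
  have hR0 : 0 < R := by positivity
  set D' := D + R + 1 with hD'
  have hD'0 : 0 < D' := by positivity
  set L := 4 * D' * (1 + R) with hL
  have hL0 : 0 ≤ L := by positivity
  refine ⟨K₀ * L ^ 2 * (2 + D) + K₀ * L * R, by positivity, fun t ht htD t' ht' => ?_⟩
  set d := Metric.infDist t (cutlocus M) with hd
  have hd0 : 0 < d := ((hM.isClosed_cutlocus hc).notMem_iff_infDist_pos ⟨c₀, hc₀⟩).1 ht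
  have htt' : ‖t' - t‖ ≤ d / 2 := ht'.resolve_left (Set.Nonempty.ne_empty ⟨c₀, hc₀⟩)
  have hd' : d / 2 ≤ Metric.infDist t' (cutlocus M) := by
    have := Metric.infDist_le_infDist_add_dist (s := cutlocus M) (x := t) (y := t')
    rw [dist_comm, dist_eq_norm] at this
    linarith
  have htC' : t' ∉ cutlocus M := by
    rw [(hM.isClosed_cutlocus hc).notMem_iff_infDist_pos ⟨c₀, hc₀⟩]
    linarith
  refine ⟨htC', ?_⟩
  have hp := isNearestPoint_of_notMem_cutlocus ht
  have hq := isNearestPoint_of_notMem_cutlocus htC'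
  have hνD : ‖t - nearestPoint M t‖ ≤ D := by rwa [norm_sub_nearestPoint_eq ht]
  have hdR : d ≤ R := by
    have h1 := Metric.infDist_le_dist_of_mem (x := t) hc₀
    have h2 := hR₀ _ hp.1
    have h3 : dist t c₀ ≤ ‖t - nearestPoint M t‖ + ‖nearestPoint M t‖ + ‖c₀‖ := by
      rw [dist_eq_norm]
      have : t - c₀ = (t - nearestPoint M t) + nearestPoint M t - c₀ := by abel
      rw [this]
      exact (norm_sub_le _ _).trans (by gcongr; exact norm_add_le _ _)
    linarith [le_abs_self R₀]
  have hνD' : ‖t' - nearestPoint M t'‖ ≤ D + R := by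
    rw [norm_sub_nearestPoint_eq htC']
    have := Metric.infDist_le_infDist_add_dist (s := M) (x := t') (y := t)
    rw [dist_eq_norm] at this
    linarith
  have hLip : ‖nearestPoint M t' - nearestPoint M t‖ ≤ L * (‖t' - t‖ / d) := by
    have hdd : d / (4 * D') * D' = d / 4 := by field_simp
    have h1 := hM.norm_nearestPoint_sub_le hc ht htC' (b := d / (4 * D')) (by positivity)
      (by
        have : d / (4 * D') * ‖t - nearestPoint M t‖ ≤ d / (4 * D') * D' := by
          gcongr; linarith
        linarith)
      (by
        have : d / (4 * D') * ‖t' - nearestPoint M t'‖ ≤ d / (4 * D') * D' := by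
          gcongr; linarith
        linarith)
    have h2 : d / (4 * D') ≤ R := by
      rw [div_le_iff₀ (by positivity)]
      nlinarith
    have h3 : d / (4 * D') * ‖nearestPoint M t' - nearestPoint M t‖ ≤ (1 + R) * ‖t' - t‖ :=
      h1.trans (by gcongr)
    have h4 : ‖nearestPoint M t' - nearestPoint M t‖ =
        4 * D' / d * (d / (4 * D') * ‖nearestPoint M t' - nearestPoint M t‖) := by
      field_simp
    rw [h4]
    calc _ ≤ 4 * D' / d * ((1 + R) * ‖t' - t‖) := by gcongr
      _ = _ := by rw [hL]; ring
  rw [stabilizer_apply]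
  refine ((hb _ hp.1 _ hq.1).norm_remainder_le hp.sub_mem_orthogonal hq.sub_mem_orthogonal).trans ?_
  calc _ ≤ K₀ * (L * (‖t' - t‖ / d)) ^ 2 * (2 + D) + K₀ * (L * (‖t' - t‖ / d)) * ‖t' - t‖ := by
        gcongr
    _ = (K₀ * L ^ 2 * (2 + D) + K₀ * L * d) * (‖t' - t‖ ^ 2 / d ^ 2) := by
      field_simp
    _ ≤ _ := by gcongr

/-- The map `stabilizer M t` is symmetric. -/
theorem IsSubmanifold.inner_stabilizer_left {m : ℕ} (hM : IsSubmanifold m M) {t : E}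
    (ht : t ∉ cutlocus M) (x y : E) :
    inner ℝ (stabilizer M t x) y = inner ℝ x (stabilizer M t y) := by
  have hp := isNearestPoint_of_notMem_cutlocus ht
  obtain ⟨V, Φ, h, ps, -⟩ := hM _ hp.1
  rw [stabilizer_apply, stabilizer_apply, inner_sub_left, inner_sub_right,
    h.inner_shape_left ps hp.1 hp.sub_mem_orthogonal]

/-- The tangential projection is continuous along `M`. -/
theorem IsSubmanifold.continuousOn_tanProj {m : ℕ} (hM : IsSubmanifold m M) :
    ContinuousOn (tanProj M) M := by
  intro p hp
  obtain ⟨V, Φ, h, ps, -⟩ := hM p hp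
  obtain ⟨T, hTd, hTM⟩ := h.exists_contDiffAt_tanProj
  refine (hTd p ps).continuousAt.continuousWithinAt.congr_of_eventuallyEq ?_ (hTM p ps hp).symm
  filter_upwards [self_mem_nhdsWithin, mem_nhdsWithin_of_mem_nhds (Φ.open_source.mem_nhds ps)]
    with q hq hqs using (hTM q hqs hq).symm

end Estimate

end CutLocus
end

noncomputable section

namespace CutLocus

/-! ### Convergence in distribution on varying probability spaces. -/

section Probability

variable {Ω : ℕ → Type*} [∀ n, MeasurableSpace (Ω n)] {P : ∀ n, Measure (Ω n)}
  [∀ n, IsProbabilityMeasure (P n)] {Ω' : Type*} [MeasurableSpace Ω'] {P' : Measure Ω'}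
  [IsProbabilityMeasure P'] {F : Type*} [NormedAddCommGroup F] [MeasurableSpace F] [BorelSpace F]

theorem tendstoInDistribution_subseq {X : ∀ n, Ω n → F} {Z : Ω' → F}
    (h : TendstoInDistribution X atTop Z P P') {ns : ℕ → ℕ} (hns : Tendsto ns atTop atTop) :
    TendstoInDistribution (fun k => X (ns k)) atTop Z (fun k => P (ns k)) P' :=
  ⟨fun k => h.forall_aemeasurable (ns k), h.aemeasurable_limit, h.tendsto.comp hns⟩

/-- Convergence in distribution can be checked along subsequences. -/
theorem tendstoInDistribution_of_subseq {X : ∀ n, Ω n → F} {Z : Ω' → F}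
    (hX : ∀ n, AEMeasurable (X n) (P n)) (hZ : AEMeasurable Z P')
    (h : ∀ ns : ℕ → ℕ, Tendsto ns atTop atTop → ∃ ms : ℕ → ℕ,
      TendstoInDistribution (fun k => X (ns (ms k))) atTop Z (fun k => P (ns (ms k))) P') :
    TendstoInDistribution X atTop Z P P' := by
  refine ⟨hX, hZ, tendsto_of_subseq_tendsto fun ns hns => ?_⟩
  obtain ⟨ms, hms⟩ := h ns hns
  exact ⟨ms, hms.tendsto⟩

/-- Only the laws matter, so the underlying spaces and the limit variable may be exchanged. -/
theorem tendstoInDistribution_of_map_eq {Ω₂ : ℕ → Type*} [∀ n, MeasurableSpace (Ω₂ n)]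
    {P₂ : ∀ n, Measure (Ω₂ n)} [∀ n, IsProbabilityMeasure (P₂ n)] {Ω₂' : Type*}
    [MeasurableSpace Ω₂'] {P₂' : Measure Ω₂'} [IsProbabilityMeasure P₂']
    {X : ∀ n, Ω n → F} {Z : Ω' → F} {X₂ : ∀ n, Ω₂ n → F} {Z₂ : Ω₂' → F}
    (h : TendstoInDistribution X atTop Z P P')
    (hX₂ : ∀ n, AEMeasurable (X₂ n) (P₂ n)) (hZ₂ : AEMeasurable Z₂ P₂')
    (hX : ∀ n, (P₂ n).map (X₂ n) = (P n).map (X n)) (hZ : P₂'.map Z₂ = P'.map Z) :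
    TendstoInDistribution X₂ atTop Z₂ P₂ P₂' := by
  refine ⟨hX₂, hZ₂, ?_⟩
  have h1 := h.tendsto.congr (f₂ := fun n => (⟨(P₂ n).map (X₂ n),
    Measure.isProbabilityMeasure_map (hX₂ n)⟩ : ProbabilityMeasure F)) fun n =>
      Subtype.ext (hX n).symm
  have h2 : (⟨P₂'.map Z₂, Measure.isProbabilityMeasure_map hZ₂⟩ : ProbabilityMeasure F) =
      ⟨P'.map Z, Measure.isProbabilityMeasure_map h.aemeasurable_limit⟩ := Subtype.ext hZ
  rw [h2]
  exact h1

/-- Asymptotic tightness of a sequence that converges in distribution. -/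
theorem exists_eventually_measure_norm_ge_lt [CompleteSpace F] [SecondCountableTopology F]
    {X : ∀ n, Ω n → F} {Z : Ω' → F} (h : TendstoInDistribution X atTop Z P P')
    {ε : ENNReal} (hε : 0 < ε) :
    ∃ R : ℝ, 0 < R ∧ ∀ᶠ n in atTop, P n {ω | R ≤ ‖X n ω‖} < ε := by
  have := Measure.isProbabilityMeasure_map h.aemeasurable_limit
  obtain ⟨ε', hε', hlt⟩ := exists_between hε
  obtain ⟨K, hK, hKε⟩ := isTightMeasureSet_iff_exists_isCompact_measure_compl_le.1
    (isTightMeasureSet_singleton (μ := P'.map Z)) ε' hε'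
  obtain ⟨R, hR, hKR⟩ := hK.isBounded.exists_pos_norm_le
  refine ⟨R + 1, by linarith, ?_⟩
  have hcl : IsClosed {x : F | R + 1 ≤ ‖x‖} := isClosed_le continuous_const continuous_norm
  have hlim := ProbabilityMeasure.limsup_measure_closed_le_of_tendsto h.tendsto hcl
  have hle : P'.map Z {x : F | R + 1 ≤ ‖x‖} ≤ ε' := by
    refine (measure_mono fun x hx hxK => ?_).trans (hKε _ rfl)
    have h1 := hKR x hxK
    have h2 : R + 1 ≤ ‖x‖ := hx
    linarith
  have hev := eventually_lt_of_limsup_lt ((hlim.trans hle).trans_lt hlt)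
  filter_upwards [hev] with n hn
  rw [ProbabilityMeasure.coe_mk, Measure.map_apply_of_aemeasurable (h.forall_aemeasurable n)
    hcl.measurableSet] at hn
  exact hn

/-- Random vectors that are negligible compared with a sequence converging in distribution. -/
theorem tendstoZeroInProbability_of_le [CompleteSpace F] [SecondCountableTopology F]
    {H : Type*} [NormedAddCommGroup H]
    {X : ∀ n, Ω n → F} {Z : Ω' → F} (h : TendstoInDistribution X atTop Z P P')
    {Y : ∀ n, Ω n → H} {a b : ℕ → ℝ} (ha : Tendsto a atTop (𝓝 0)) (ha0 : ∀ n, 0 ≤ a n)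
    (hb : Tendsto b atTop (𝓝 0)) (hb0 : ∀ n, 0 ≤ b n)
    (hY : ∀ n, ∀ᵐ ω ∂(P n), b n * ‖X n ω‖ ≤ 1 / 2 → ‖Y n ω‖ ≤ a n * (‖X n ω‖ ^ 2 + 1)) :
    TendstoZeroInProbability P Y := by
  intro ε hε
  rw [ENNReal.tendsto_nhds_zero]
  intro η hη
  -- Outside an event of probability below `η` one has `‖X n‖ < R`; for large `n` the smallness
  -- condition then holds and the bound falls below `ε`.
  obtain ⟨R, hR, hev⟩ := exists_eventually_measure_norm_ge_lt h hη
  have h1 : ∀ᶠ n in atTop, b n * R < 1 / 2 := by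
    have := hb.mul_const R
    rw [zero_mul] at this
    exact this.eventually_lt_const (by norm_num)
  have h2 : ∀ᶠ n in atTop, a n * (R ^ 2 + 1) < ε := by
    have := ha.mul_const (R ^ 2 + 1)
    rw [zero_mul] at this
    exact this.eventually_lt_const hε
  filter_upwards [hev, h1, h2] with n hn hbn han
  refine (measure_mono_ae ?_).trans hn.le
  filter_upwards [hY n] with ω hω hε'
  by_contra hcon
  have hX : ‖X n ω‖ ≤ R := (not_le.1 hcon).le
  have h3 := hω ((mul_le_mul_of_nonneg_left hX (hb0 n)).trans hbn.le)
  have h4 : a n * (‖X n ω‖ ^ 2 + 1) ≤ a n * (R ^ 2 + 1) :=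
    mul_le_mul_of_nonneg_left (by gcongr) (ha0 n)
  have h5 : ε ≤ ‖Y n ω‖ := hε'
  linarith

/-- Slutsky's lemma for random vectors on different probability spaces. -/
theorem tendstoInDistribution_of_tendstoZeroInProbability_sub [SecondCountableTopology F]
    {X Y : ∀ n, Ω n → F} {Z : Ω' → F} (h : TendstoInDistribution X atTop Z P P')
    (hY : ∀ n, AEMeasurable (Y n) (P n))
    (hXY : TendstoZeroInProbability P fun n ω => Y n ω - X n ω) :
    TendstoInDistribution Y atTop Z P P' := by
  -- All variables are moved to the product space, where the single-space form of Slutsky's lemma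
  -- applies; the coordinate maps preserve the laws and the probabilities involved.
  have hpres : ∀ n, MeasurePreserving (Function.eval n) (Measure.infinitePi P) (P n) :=
    fun n => measurePreserving_eval_infinitePi P n
  have hm : ∀ (W : ∀ n, Ω n → F), (∀ n, AEMeasurable (W n) (P n)) → ∀ n,
      (Measure.infinitePi P).map (fun ω => W n (ω n)) = (P n).map (W n) := by
    intro W hW n
    rw [← (hpres n).map_eq, AEMeasurable.map_map_of_aemeasurable
      (by rw [(hpres n).map_eq]; exact hW n) (hpres n).measurable.aemeasurable]
    rfl
  have hae : ∀ (W : ∀ n, Ω n → F), (∀ n, AEMeasurable (W n) (P n)) → ∀ n,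
      AEMeasurable (fun ω => W n (ω n)) (Measure.infinitePi P) := fun W hW n =>
    (hW n).comp_quasiMeasurePreserving (hpres n).quasiMeasurePreserving
  have hX := h.forall_aemeasurable
  have h1 : TendstoInDistribution (fun n (ω : ∀ n, Ω n) => X n (ω n)) atTop Z
      (fun _ => Measure.infinitePi P) P' :=
    tendstoInDistribution_of_map_eq h (hae X hX) h.aemeasurable_limit (hm X hX) rfl
  have h2 : TendstoInDistribution (fun n (ω : ∀ n, Ω n) => Y n (ω n)) atTop Z
      (fun _ => Measure.infinitePi P) P' := by
    refine tendstoInDistribution_of_tendstoInMeasure_sub _ Z h1 ?_ (hae Y hY)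
    rw [tendstoInMeasure_iff_norm]
    intro ε hε
    refine (hXY ε hε).congr fun n => ?_
    have hs : NullMeasurableSet {ω | ε ≤ ‖Y n ω - X n ω‖} (P n) :=
      nullMeasurableSet_le aemeasurable_const ((hY n).sub (hX n)).norm
    rw [← (hpres n).measure_preimage hs]
    simp
  exact tendstoInDistribution_of_map_eq h2 hY h.aemeasurable_limit (fun n => (hm Y hY n).symm) rfl

/-- By tightness `(Q n - Q₀) (X n)` is negligible, so this reduces to the continuous mapping theorem
and Slutsky's lemma. -/
theorem tendstoInDistribution_clm_apply [CompleteSpace F] [SecondCountableTopology F]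
    [NormedSpace ℝ F]
    {X : ∀ n, Ω n → F} {Z : Ω' → F} (h : TendstoInDistribution X atTop Z P P')
    {Q : ℕ → F →L[ℝ] F} {Q₀ : F →L[ℝ] F} (hQ : Tendsto Q atTop (𝓝 Q₀)) :
    TendstoInDistribution (fun n ω => Q n (X n ω)) atTop (fun ω => Q₀ (Z ω)) P P' := by
  refine tendstoInDistribution_of_tendstoZeroInProbability_sub
    (h.continuous_comp Q₀.continuous)
    (fun n => (Q n).continuous.measurable.comp_aemeasurable (h.forall_aemeasurable n)) ?_
  refine tendstoZeroInProbability_of_le h (a := fun n => ‖Q n - Q₀‖) (b := fun _ => 0)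
    (tendsto_iff_norm_sub_tendsto_zero.1 hQ) (fun _ => norm_nonneg _) tendsto_const_nhds
    (fun _ => le_rfl) fun n => .of_forall fun ω _ => ?_
  calc _ ≤ ‖Q n - Q₀‖ * ‖X n ω‖ := (Q n - Q₀).le_opNorm (X n ω)
    _ ≤ _ := by
      gcongr
      nlinarith [sq_nonneg (‖X n ω‖ - 1), norm_nonneg (X n ω)]

end Probability

/-! ### Spherical vectors under maps with `Q Q*` a projection. -/

section Spherical

variable {E : Type*} [NormedAddCommGroup E] [InnerProductSpace ℝ E] [FiniteDimensional ℝ E]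

/-- A map with `Q Q* = P_U` is the orthogonal projection onto `U` after an isometry. -/
theorem exists_isometry_of_comp_adjoint_eq {Q : E →L[ℝ] E} {U : Submodule ℝ E}
    (hQ : Q ∘L ContinuousLinearMap.adjoint Q = U.starProjection) :
    ∃ H : E ≃ₗᵢ[ℝ] E, ∀ x, Q x = U.starProjection (H x) := by
  have hnorm : ∀ y, ‖ContinuousLinearMap.adjoint Q y‖ = ‖U.starProjection y‖ := by
    intro y
    have h1 : ‖ContinuousLinearMap.adjoint Q y‖ ^ 2 = ‖U.starProjection y‖ ^ 2 := by
      rw [← real_inner_self_eq_norm_sq, ← real_inner_self_eq_norm_sq,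
        ContinuousLinearMap.adjoint_inner_left, Submodule.inner_starProjection_left_eq_right]
      have h2 : Q (ContinuousLinearMap.adjoint Q y) = U.starProjection y :=
        congrArg (fun A : E →L[ℝ] E => A y) hQ
      rw [h2, Submodule.starProjection_eq_self_iff.2 (Submodule.starProjection_apply_mem U y)]
    exact (sq_eq_sq₀ (norm_nonneg _) (norm_nonneg _)).1 h1
  -- `Q*` is isometric on `U` and vanishes on its complement. Extending the isometry to all of `E`
  -- as `L'` gives `Q* = L' P_U`, hence `Q = P_U L'⁻¹`.
  let L : U →ₗᵢ[ℝ] E :=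
    { toLinearMap := (ContinuousLinearMap.adjoint Q : E →ₗ[ℝ] E) ∘ₗ U.subtype
      norm_map' := fun u => by
        simpa [Submodule.starProjection_eq_self_iff.2 u.2] using hnorm u }
  let L' : E ≃ₗᵢ[ℝ] E := L.extend.toLinearIsometryEquiv rfl
  have hL' : ∀ y, L' (U.starProjection y) = ContinuousLinearMap.adjoint Q y := by
    intro y
    have hmem := Submodule.starProjection_apply_mem U y
    have h1 : L' (U.starProjection y) = ContinuousLinearMap.adjoint Q (U.starProjection y) :=
      LinearIsometry.extend_apply L ⟨_, hmem⟩
    have h2 : ContinuousLinearMap.adjoint Q (y - U.starProjection y) = 0 := by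
      rw [← norm_eq_zero, hnorm, map_sub, Submodule.starProjection_eq_self_iff.2 hmem, sub_self,
        norm_zero]
    rw [h1, ← sub_eq_zero, ← map_sub, ← neg_eq_zero, ← map_neg, neg_sub, h2]
  refine ⟨L'.symm, fun x => ext_inner_right ℝ fun y => ?_⟩
  rw [Submodule.inner_starProjection_left_eq_right, ← LinearIsometryEquiv.inner_map_map L' (L'.symm x),
    LinearIsometryEquiv.apply_symm_apply, hL', ContinuousLinearMap.adjoint_inner_right]

variable [MeasurableSpace E] [BorelSpace E]
  {Ω : ℕ → Type*} [∀ n, MeasurableSpace (Ω n)] {P : ∀ n, Measure (Ω n)}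
  [∀ n, IsProbabilityMeasure (P n)] {Ω' : Type*} [MeasurableSpace Ω'] {P' : Measure Ω'}
  [IsProbabilityMeasure P']

/-- The `Q n` need not converge, but `‖Q n‖ ^ 2 = ‖T n‖ ≤ 1` gives convergent subsequences. Each
limit is `P_U H` with `H` an isometry, and sphericity makes the law of `P_U H Z` that of `P_U Z`. -/
theorem tendstoInDistribution_of_comp_adjoint_tendsto {X : ∀ n, Ω n → E} {Z : Ω' → E}
    (h : TendstoInDistribution X atTop Z P P') (hZ : IsSpherical Z P')
    {Q T : ℕ → E →L[ℝ] E} {U : Submodule ℝ E} (hT : ∀ n, ‖T n‖ ≤ 1)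
    (hQ : ∀ n, Q n ∘L ContinuousLinearMap.adjoint (Q n) = T n)
    (hTU : Tendsto T atTop (𝓝 U.starProjection)) :
    TendstoInDistribution (fun n ω => Q n (X n ω)) atTop (fun ω => U.starProjection (Z ω)) P P' := by
  have hQ1 : ∀ n, Q n ∈ Metric.closedBall (0 : E →L[ℝ] E) 1 := by
    intro n
    have h1 : ‖Q n‖ * ‖Q n‖ ≤ 1 := by
      have := ContinuousLinearMap.norm_adjoint_comp_self (ContinuousLinearMap.adjoint (Q n))
      rw [ContinuousLinearMap.adjoint_adjoint, hQ n, LinearIsometryEquiv.norm_map] at this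
      rw [← this]
      exact hT n
    rw [mem_closedBall_zero_iff]
    nlinarith [norm_nonneg (Q n)]
  have hpr : ProperSpace (E →L[ℝ] E) := FiniteDimensional.proper ℝ _
  refine tendstoInDistribution_of_subseq
    (fun n => (Q n).continuous.measurable.comp_aemeasurable (h.forall_aemeasurable n))
    (U.starProjection.continuous.measurable.comp_aemeasurable h.aemeasurable_limit)
    fun ns hns => ?_
  obtain ⟨Q₀, -, ms, hms, hlim⟩ := (isCompact_closedBall (0 : E →L[ℝ] E) 1).tendsto_subseq
    (fun k => hQ1 (ns k))
  refine ⟨ms, ?_⟩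
  have hns' : Tendsto (fun k => ns (ms k)) atTop atTop := hns.comp hms.tendsto_atTop
  have hQ₀ : Q₀ ∘L ContinuousLinearMap.adjoint Q₀ = U.starProjection := by
    have h1 : Tendsto (fun k => Q (ns (ms k)) ∘L ContinuousLinearMap.adjoint (Q (ns (ms k))))
        atTop (𝓝 (Q₀ ∘L ContinuousLinearMap.adjoint Q₀)) :=
      ((continuous_id.clm_comp (adjointCLM E E).continuous).tendsto Q₀).comp hlim
    refine tendsto_nhds_unique h1 ?_
    simp only [hQ]
    exact hTU.comp hns'
  obtain ⟨H, hH⟩ := exists_isometry_of_comp_adjoint_eq hQ₀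
  have h2 := tendstoInDistribution_clm_apply (tendstoInDistribution_subseq h hns') hlim
  refine tendstoInDistribution_of_map_eq h2 h2.forall_aemeasurable
    (U.starProjection.continuous.measurable.comp_aemeasurable h.aemeasurable_limit)
    (fun _ => rfl) ?_
  simp only [hH]
  exact ((hZ H).comp U.starProjection.continuous.measurable).map_eq.symm

end Spherical

/-- The law of the squared length of an orthogonal projection of a spherical vector. -/
theorem identDistrib_norm_starProjection_sq {s m : ℕ} {Ω' : Type*} [MeasurableSpace Ω']
    {P' : Measure Ω'} {Z : Ω' → EuclideanSpace ℝ (Fin s)} (hZ : IsSpherical Z P')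
    (U : Submodule ℝ (EuclideanSpace ℝ (Fin s))) (hU : Module.finrank ℝ U = m) :
    IdentDistrib (fun ω => ‖U.starProjection (Z ω)‖ ^ 2)
      (fun ω => ∑ i : Fin s with i.val < m, Z ω i ^ 2) P' P' := by
  subst hU
  set m := Module.finrank ℝ U with hm
  have hms : m ≤ s := by simpa using U.finrank_le
  let u := stdOrthonormalBasis ℝ U
  -- An orthonormal basis of `U` occupies the indices below `m`; the value `0` elsewhere is a
  -- filler, replaced on extending to a basis of the whole space. The coordinate isometry of that
  -- basis is the one fed to sphericity.
  let v : Fin s → EuclideanSpace ℝ (Fin s) := fun i =>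
    if h : i.val < m then (u ⟨i.val, h⟩ : EuclideanSpace ℝ (Fin s)) else 0
  have hv : Orthonormal ℝ (Set.domRestrict {i : Fin s | i.val < m} v) := by
    have h1 : Orthonormal ℝ (fun j : Fin m => (u j : EuclideanSpace ℝ (Fin s))) :=
      u.orthonormal.comp_linearIsometry U.subtypeₗᵢ
    have h2 : Set.domRestrict {i : Fin s | i.val < m} v =
        (fun j : Fin m => (u j : EuclideanSpace ℝ (Fin s))) ∘ fun i => ⟨i.1.val, i.2⟩ := by
      ext1 i
      have : i.1.val < m := i.2
      simp [v, this]
    rw [h2]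
    refine h1.comp _ fun i j hij => ?_
    simp only [Fin.mk.injEq] at hij
    exact Subtype.ext (Fin.ext hij)
  obtain ⟨b, hb⟩ := hv.exists_orthonormalBasis_extension_of_card_eq (by simp)
  have hsum : ∀ x, ‖U.starProjection x‖ ^ 2 = ∑ i : Fin s with i.val < m, b.repr x i ^ 2 := by
    intro x
    have h1 : ‖U.starProjection x‖ ^ 2 = ∑ j : Fin m, inner ℝ (u j : EuclideanSpace ℝ (Fin s)) x ^ 2 := by
      have h2 := u.sum_sq_norm_inner_right (U.orthogonalProjectionOnto x)
      have h3 : ‖U.starProjection x‖ = ‖U.orthogonalProjectionOnto x‖ := rfl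
      rw [h3, ← h2]
      refine Finset.sum_congr rfl fun j _ => ?_
      rw [Real.norm_eq_abs, sq_abs]
      congr 1
      have h4 : inner ℝ (u j) (U.orthogonalProjectionOnto x) =
          inner ℝ (u j : EuclideanSpace ℝ (Fin s)) (U.starProjection x) := rfl
      rw [h4, ← Submodule.inner_starProjection_left_eq_right,
        Submodule.starProjection_eq_self_iff.2 (u j).2]
    rw [h1]
    symm
    refine Finset.sum_bij' (fun i hi => ⟨i.val, (Finset.mem_filter.1 hi).2⟩)
      (fun j _ => ⟨j.val, j.2.trans_le hms⟩) (by simp) (by simp) (by simp) (by simp) ?_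
    intro i hi
    have hi' : i.val < m := (Finset.mem_filter.1 hi).2
    rw [b.repr_apply_apply, hb i hi']
    simp [v, hi']
  simp only [hsum]
  exact (hZ b.repr).comp
    (u := fun z : EuclideanSpace ℝ (Fin s) => ∑ i : Fin s with i.val < m, z i ^ 2)
    (by fun_prop)

end CutLocus
end

/-! ### The expansion in probability and the main theorem. -/

noncomputable section

namespace CutLocus

/-- The first order expansion of the nearest-point mapping, in probability. -/
theorem tendstoZeroInProbability_nearestPoint {E : Type*} [NormedAddCommGroup E]
    [InnerProductSpace ℝ E] [FiniteDimensional ℝ E] [MeasurableSpace E] [BorelSpace E]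
    {m : ℕ} {M : Set E} (hc : IsCompact M) (hM : IsSubmanifold m M)
    {Ω : ℕ → Type*} [∀ n, MeasurableSpace (Ω n)] {P : ∀ n, Measure (Ω n)}
    [∀ n, IsProbabilityMeasure (P n)] {Ω' : Type*} [MeasurableSpace Ω'] {P' : Measure Ω'}
    [IsProbabilityMeasure P'] {t : ℕ → E} {B : ℕ → E →L[ℝ] E} {Zn : ∀ n, Ω n → E} {Z : Ω' → E}
    (hZ : TendstoInDistribution Zn atTop Z P P') {μ' : ∀ n, Ω n → E}
    (hμ' : ∀ n, ∀ᵐ ω ∂(P n), t n + B n (Zn n ω) ∉ cutlocus M →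
      μ' n ω = nearestPoint M (t n + B n (Zn n ω)))
    (htC : ∀ n, t n ∉ cutlocus M) {D : ℝ} (hD : 0 < D) (htM : ∀ n, Metric.infDist (t n) M ≤ D)
    (hBC : Tendsto (fun n => (Metric.infDist (t n) (cutlocus M))⁻¹ • B n) atTop (𝓝 0))
    {Γ : ℕ → E →L[ℝ] E}
    (hΓ : Tendsto (fun n => ‖Γ n‖ * ‖B n‖ ^ 2 / Metric.infDist (t n) (cutlocus M) ^ 2)
      atTop (𝓝 0)) :
    TendstoZeroInProbability P (fun n ω =>
      Γ n (stabilizer M (t n) (μ' n ω - nearestPoint M (t n))) -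
        Γ n (tanProj M (nearestPoint M (t n)) (B n (Zn n ω)))) := by
  obtain ⟨K, hK, hest⟩ := hM.exists_norm_stabilizer_sub_le hc hD
  -- The threshold `b n * ‖Zn‖ ≤ 1 / 2` is exactly the requirement that `t̃ₙ` be within half the
  -- distance of `tₙ` to the cutlocus.
  refine tendstoZeroInProbability_of_le hZ
    (a := fun n => K * (‖Γ n‖ * ‖B n‖ ^ 2 / Metric.infDist (t n) (cutlocus M) ^ 2))
    (b := fun n => ‖(Metric.infDist (t n) (cutlocus M))⁻¹ • B n‖)
    (by simpa using hΓ.const_mul K) (fun n => by positivity)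
    (tendsto_zero_iff_norm_tendsto_zero.1 hBC) (fun n => norm_nonneg _) fun n => ?_
  filter_upwards [hμ' n] with ω hω hsmall
  have hBle : ‖B n (Zn n ω)‖ ≤ ‖B n‖ * ‖Zn n ω‖ := (B n).le_opNorm _
  have hcond : cutlocus M = ∅ ∨ ‖t n + B n (Zn n ω) - t n‖ ≤
      Metric.infDist (t n) (cutlocus M) / 2 := by
    rcases (cutlocus M).eq_empty_or_nonempty with h0 | h0
    · exact Or.inl h0
    · right
      have hd : 0 < Metric.infDist (t n) (cutlocus M) :=
        ((hM.isClosed_cutlocus hc).notMem_iff_infDist_pos h0).1 (htC n)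
      rw [norm_smul, norm_inv, Real.norm_of_nonneg hd.le, mul_assoc, inv_mul_le_iff₀ hd] at hsmall
      rw [add_sub_cancel_left]
      linarith
  obtain ⟨hnot, hle⟩ := hest (t n) (htC n) (htM n) (t n + B n (Zn n ω)) hcond
  rw [add_sub_cancel_left] at hle
  rw [hω hnot, ← map_sub]
  calc _ ≤ ‖Γ n‖ * (K * (‖B n (Zn n ω)‖ ^ 2 / Metric.infDist (t n) (cutlocus M) ^ 2)) :=
        (Γ n).le_opNorm_of_le hle
    _ ≤ ‖Γ n‖ * (K * ((‖B n‖ * ‖Zn n ω‖) ^ 2 / Metric.infDist (t n) (cutlocus M) ^ 2)) := by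
      gcongr
    _ = K * (‖Γ n‖ * ‖B n‖ ^ 2 / Metric.infDist (t n) (cutlocus M) ^ 2) * ‖Zn n ω‖ ^ 2 := by
      ring
    _ ≤ _ := by
      gcongr
      linarith

end CutLocus
end

theorem theorem2p2 (s m : ℕ)
    (M : Set (EuclideanSpace ℝ (Fin s))) (hMcompact : IsCompact M)
    (hM : CutLocus.IsSubmanifold m M)
    -- the probability spaces carrying the random vectors `t̃ₙ`, and the one carrying `Z`
    {Ω : ℕ → Type*} [∀ n, MeasurableSpace (Ω n)] (P : ∀ n, Measure (Ω n))
    [∀ n, IsProbabilityMeasure (P n)]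
    {Ω' : Type*} [MeasurableSpace Ω'] (P' : Measure Ω') [IsProbabilityMeasure P']
    (t : ℕ → EuclideanSpace ℝ (Fin s))
    (t' : ∀ n, Ω n → EuclideanSpace ℝ (Fin s))
    -- the nonsingular matrices `Bₙ → 0` and the limit theorem for `Zₙ = Bₙ⁻¹ (t̃ₙ - tₙ)`
    (B : ℕ → (EuclideanSpace ℝ (Fin s) ≃L[ℝ] EuclideanSpace ℝ (Fin s)))
    (hB : Tendsto (fun n => (B n : EuclideanSpace ℝ (Fin s) →L[ℝ] EuclideanSpace ℝ (Fin s)))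
      atTop (𝓝 0))
    (Zn : ∀ n, Ω n → EuclideanSpace ℝ (Fin s))
    (hZn : ∀ n ω, Zn n ω = (B n).symm (t' n ω - t n))
    (Z : Ω' → EuclideanSpace ℝ (Fin s))
    (hZ : TendstoInDistribution Zn atTop Z P P')
    -- `μₙ = π(tₙ)` and `μ̃ₙ = π(t̃ₙ)`, where the latter is any random vector if `t̃ₙ ∈ C`
    (μ : ℕ → EuclideanSpace ℝ (Fin s))
    (hμ : ∀ n, μ n = CutLocus.nearestPoint M (t n))
    (μ' : ∀ n, Ω n → EuclideanSpace ℝ (Fin s))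
    (hμ'meas : ∀ n, AEMeasurable (μ' n) (P n))
    (hμ' : ∀ n, ∀ᵐ ω ∂(P n), t' n ω ∉ CutLocus.cutlocus M →
      μ' n ω = CutLocus.nearestPoint M (t' n ω))
    -- position of `tₙ` relative to the cutlocus and to `M`
    (htC : ∀ n, t n ∉ CutLocus.cutlocus M)
    (htM : ∃ D > 0, ∀ n, Metric.infDist (t n) M ≤ D)
    (hBC : Tendsto (fun n => (Metric.infDist (t n) (CutLocus.cutlocus M))⁻¹ •
      (B n : EuclideanSpace ℝ (Fin s) →L[ℝ] EuclideanSpace ℝ (Fin s))) atTop (𝓝 0))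
    (G : ℕ → (EuclideanSpace ℝ (Fin s) →L[ℝ] EuclideanSpace ℝ (Fin s)))
    (hG : ∀ n, G n = CutLocus.stabilizer M (t n))
    (Γ : ℕ → (EuclideanSpace ℝ (Fin s) →L[ℝ] EuclideanSpace ℝ (Fin s)))
    (hΓ : Tendsto (fun n => ‖Γ n‖ *
      ‖(B n : EuclideanSpace ℝ (Fin s) →L[ℝ] EuclideanSpace ℝ (Fin s))‖ ^ 2 /
        Metric.infDist (t n) (CutLocus.cutlocus M) ^ 2) atTop (𝓝 0)) :
    CutLocus.TendstoZeroInProbability P (fun n ω =>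
        Γ n (G n (μ' n ω - μ n)) - Γ n (CutLocus.tanProj M (μ n) (B n (Zn n ω)))) ∧
      (CutLocus.IsSpherical Z P' →
        (∀ n, Γ n ∘L CutLocus.tanProj M (μ n) ∘L
            (B n : EuclideanSpace ℝ (Fin s) →L[ℝ] EuclideanSpace ℝ (Fin s)) ∘L
            ContinuousLinearMap.adjoint
              (B n : EuclideanSpace ℝ (Fin s) →L[ℝ] EuclideanSpace ℝ (Fin s)) ∘L
            CutLocus.tanProj M (μ n) ∘L ContinuousLinearMap.adjoint (Γ n) =
          CutLocus.tanProj M (μ n)) →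
        (∀ μ₀ ∈ M, Tendsto μ atTop (𝓝 μ₀) →
          TendstoInDistribution (fun n ω => Γ n (G n (μ' n ω - μ n))) atTop
            (fun ω => CutLocus.tanProj M μ₀ (Z ω)) P P') ∧
        TendstoInDistribution
          (fun n ω => inner ℝ (μ' n ω - μ n)
            (G n (ContinuousLinearMap.adjoint (Γ n) (Γ n (G n (μ' n ω - μ n))))))
          atTop (fun ω => ∑ i : Fin s with i.val < m, Z ω i ^ 2) P P') := by
  obtain ⟨D, hD, htD⟩ := htM
  obtain rfl : μ = fun n => CutLocus.nearestPoint M (t n) := funext hμ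
  obtain rfl : G = fun n => CutLocus.stabilizer M (t n) := funext hG
  have ht' : ∀ n ω, t' n ω = t n + B n (Zn n ω) := fun n ω => by simp [hZn]
  have hmem : ∀ n, CutLocus.nearestPoint M (t n) ∈ M := fun n =>
    (CutLocus.isNearestPoint_of_notMem_cutlocus (htC n)).1
  have h1 := CutLocus.tendstoZeroInProbability_nearestPoint hMcompact hM hZ
    (B := fun n => (B n : EuclideanSpace ℝ (Fin s) →L[ℝ] EuclideanSpace ℝ (Fin s)))
    (fun n => (hμ' n).mono fun ω h => by rw [ht'] at h; exact h) htC hD htD hBC hΓ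
  refine ⟨h1, fun hsph h27 => ?_⟩
  have hXmeas : ∀ n, AEMeasurable (fun ω => Γ n (CutLocus.stabilizer M (t n)
      (μ' n ω - CutLocus.nearestPoint M (t n)))) (P n) := fun n =>
    ((Γ n).continuous.comp (CutLocus.stabilizer M (t n)).continuous).measurable.comp_aemeasurable
      ((hμ'meas n).sub_const _)
  -- Stated along subsequences in order to serve both conclusions: the identity for convergent `μₙ`,
  -- and subsequences from compactness of `M` otherwise.
  have key : ∀ μ₀ ∈ M, ∀ ns : ℕ → ℕ, Tendsto ns atTop atTop →
      Tendsto (fun k => CutLocus.nearestPoint M (t (ns k))) atTop (𝓝 μ₀) →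
      TendstoInDistribution (fun k ω => Γ (ns k) (CutLocus.stabilizer M (t (ns k))
          (μ' (ns k) ω - CutLocus.nearestPoint M (t (ns k))))) atTop
        (fun ω => CutLocus.tanProj M μ₀ (Z ω)) (fun k => P (ns k)) P' := by
    intro μ₀ hμ₀ ns hns hlim
    refine CutLocus.tendstoInDistribution_of_tendstoZeroInProbability_sub ?_
      (fun k => hXmeas (ns k)) (fun ε hε => (h1 ε hε).comp hns)
    refine CutLocus.tendstoInDistribution_of_comp_adjoint_tendsto
      (T := fun k => CutLocus.tanProj M (CutLocus.nearestPoint M (t (ns k))))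
      (Q := fun k => Γ (ns k) ∘L CutLocus.tanProj M (CutLocus.nearestPoint M (t (ns k))) ∘L
        (B (ns k) : EuclideanSpace ℝ (Fin s) →L[ℝ] EuclideanSpace ℝ (Fin s)))
      (U := CutLocus.tangentSpace M μ₀)
      (CutLocus.tendstoInDistribution_subseq hZ hns) hsph (fun k => CutLocus.norm_tanProj_le _ _)
      (fun k => ?_) ?_
    -- The normalization hypothesis is `Q Q* = tan`, since `tan` is self-adjoint.
    · refine Eq.trans ?_ (h27 (ns k))
      have hadj : ContinuousLinearMap.adjoint
          (CutLocus.tanProj M (CutLocus.nearestPoint M (t (ns k)))) =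
            CutLocus.tanProj M (CutLocus.nearestPoint M (t (ns k))) :=
        ContinuousLinearMap.isSelfAdjoint_iff'.1 (isSelfAdjoint_starProjection _)
      simp only [ContinuousLinearMap.adjoint_comp, hadj, ContinuousLinearMap.comp_assoc]
    · refine (hM.continuousOn_tanProj μ₀ hμ₀).tendsto.comp (tendsto_nhdsWithin_iff.2 ⟨hlim, ?_⟩)
      exact .of_forall fun k => hmem (ns k)
  refine ⟨fun μ₀ hμ₀ hlim => key μ₀ hμ₀ id tendsto_id hlim, ?_⟩
  -- Symmetry of the Weingarten mapping makes `G` self-adjoint, so the quadratic form is a squared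
  -- norm.
  have hsq : ∀ n ω, inner ℝ (μ' n ω - CutLocus.nearestPoint M (t n))
      (CutLocus.stabilizer M (t n) (ContinuousLinearMap.adjoint (Γ n) (Γ n
        (CutLocus.stabilizer M (t n) (μ' n ω - CutLocus.nearestPoint M (t n)))))) =
      ‖Γ n (CutLocus.stabilizer M (t n) (μ' n ω - CutLocus.nearestPoint M (t n)))‖ ^ 2 := by
    intro n ω
    rw [← hM.inner_stabilizer_left (htC n), ContinuousLinearMap.adjoint_inner_right,
      real_inner_self_eq_norm_sq]
  simp only [hsq]
  have hZmeas : AEMeasurable (fun ω => ∑ i : Fin s with i.val < m, Z ω i ^ 2) P' :=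
    (Continuous.measurable (f := fun z : EuclideanSpace ℝ (Fin s) =>
      ∑ i : Fin s with i.val < m, z i ^ 2) (by fun_prop)).comp_aemeasurable hZ.aemeasurable_limit
  refine CutLocus.tendstoInDistribution_of_subseq (fun n => (hXmeas n).norm.pow_const 2) hZmeas
    fun ns hns => ?_
  -- The limit `‖tan_{μ₀} Z‖ ^ 2` has the same law for every `μ₀ ∈ M`, so agreement along
  -- subsequences suffices.
  obtain ⟨μ₀, hμ₀, ms, hms, hlim⟩ := hMcompact.tendsto_subseq (fun k => hmem (ns k))
  have h2 := (key μ₀ hμ₀ (fun k => ns (ms k)) (hns.comp hms.tendsto_atTop) hlim).continuous_comp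
    (g := fun z => ‖z‖ ^ 2) (by fun_prop)
  exact ⟨ms, CutLocus.tendstoInDistribution_of_map_eq h2 h2.forall_aemeasurable hZmeas
    (fun _ => rfl) (CutLocus.identDistrib_norm_starProjection_sq hsph _
      (hM.finrank_tangentSpace hμ₀)).map_eq.symm⟩
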